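/- Let $D=(0,1)$, $n\geqslant 1$, $0<\alpha_1<\dots<\alpha_n\leqslant 2$ with $\alpha_1<2$, $\alpha_{\max}:=\max\{\alpha_i:\alpha_i\neq 2\}$, and let $B^H$ be a fractional Brownian motion on $\mathbb R$ with Hurst index $H\in(0,1)$, that is, a centered Gaussian process with covariance $\frac12(|x|^{2H}+|y|^{2H}-|x-y|^{2H})$. For $\omega\in\mathbb R$ let $s=\sum_{k=1}^n(\mathrm i\omega)^{\alpha_k}$ (principal values) and let $G_\omega$ be the Green function of $\partial_{xx}G-sG=\delta(x-y)$ on $D$ with $\partial_xG(0,y)=0$, $G(1,y)=0$, that is, $G_0(x,y)=\max\{x,y\}-1$ and, for $\omega\neq0$, $$G_\omega(x,y)=\frac{e^{\sqrt s(x+y)}+e^{\sqrt s|x-y|}-e^{\sqrt s(2-x-y)}-e^{\sqrt s(2-|x-y|)}}{2\sqrt s\,(1+e^{2\sqrt s})},$$ with the principal square root; in particular $G_\omega(0,y)=\dfrac{e^{\sqrt s y}-e^{\sqrt s(2-y)}}{\sqrt s(1+e^{2\sqrt s})}$ for $\omega\ne0$. The integral $\int_D g\,dB^H$ of a deterministic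 function $g\in L^2(D)$ is the mean square limit of the elementary integrals $\sum_i c_i(B^H(b_i)-B^H(a_i))$ of step functions $\sum_i c_i\mathbf 1_{(a_i,b_i]}$, $0\leqslant a_i\leqslant b_i\leqslant1$, that converge to the zero extension of $g$ in the norm $u\mapsto\big(\int_{\mathbb R}(1+\zeta^2)^{\gamma}|\hat u(\zeta)|^2d\zeta\big)^{1/2}$ with $\gamma=\max\{0,\frac12-H\}$, where $\hat u(\zeta)=\int u(t)e^{-\mathrm i\zeta t}dt$. For every $\omega\in\mathbb R$, the integral $\int_D G_\omega(0,y)\,dB^H(y)$ exists and is almost surely unique. Put $$R(\omega)=\mathbb E\Big|\int_D G_\omega(0,y)\,dB^H(y)\Big|^2 .$$ (1) If $H\in[\frac12,1)$, there is a constant $C>0$, depending only on $H$ and $\alpha_1,\dots,\alpha_n$, such that $R(\omega)\leqslant C|\omega|^{-\alpha_{\max}}$ for all $|\omega|>1$. (2) If $H\in(0,\frac12)$ and $\alpha_n<2$, then $\lim_{|\omega|\to\infty}R(\omega)=0$. (3) Consequently, if $H\in[\frac12,1)$ or $\alpha_n<2$, the recovery of $|\hat f(\omega)|$ from the variance $\mathbb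 V_f(\omega)=\mathbb E|\hat u-\mathbb E\hat u|^2$ of the boundary data $\hat u=\hat u(0,\omega)=-\hat f(\omega)\int_DG_\omega(0,y)\,dB^H(y)$ is unstable at high frequencies: for every integrable $f:\mathbb R\to\mathbb R$ vanishing on $(-\infty,0]$ and all $M,\delta>0$ there is $W$ such that for every $|\omega|>W$ there is $\varphi\in C_c^\infty((0,\infty);\mathbb R)$ with $\big||\widehat{f+\varphi}(\omega)|-|\hat f(\omega)|\big|\geqslant M$ and $|\mathbb V_{f+\varphi}(\omega)-\mathbb V_f(\omega)|\leqslant\delta$. -/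

import Mathlib

open MeasureTheory ProbabilityTheory Filter Topology
open scoped ENNReal

noncomputable section

namespace FracDiffusionWave

/-! ### Fractional Brownian motion -/

/-- `B` is a two-sided fractional Brownian motion with Hurst index `H` on the probability
space `(Ω, P)`: a centered Gaussian process indexed by `ℝ` with covariance
`(|x|^{2H} + |y|^{2H} - |x - y|^{2H}) / 2`. -/
structure IsFBM {Ω : Type*} [MeasurableSpace Ω] (P : Measure Ω) (H : ℝ) (B : ℝ → Ω → ℝ) :
    Prop where
  gaussian : IsGaussianProcess B P
  centered : ∀ x, ∫ o, B x o ∂P = 0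
  cov : ∀ x y, ∫ o, B x o * B y o ∂P
    = (|x| ^ (2 * H) + |y| ^ (2 * H) - |x - y| ^ (2 * H)) / 2

/-! ### Fourier transform and Sobolev norm -/

/-- The Fourier transform `v̂(ζ) = ∫ v(t) e^{-iζt} dt` of an integrable function. -/
def fourierT (v : ℝ → ℂ) (ζ : ℝ) : ℂ :=
  ∫ t : ℝ, v t * Complex.exp (-(Complex.I * ζ * t))

/-- The square `∫ (1 + |ζ|²)^γ |û(ζ)|² dζ ∈ [0, ∞]` of the norm of the fractional Sobolev space
of order `γ` on `ℝ`; it is used only for `u ∈ L¹ ∩ L²`. -/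
def sobolevNormSq (γ : ℝ) (u : ℝ → ℂ) : ℝ≥0∞ :=
  ∫⁻ ζ : ℝ, ENNReal.ofReal ((1 + ζ ^ 2) ^ γ * ‖fourierT u ζ‖ ^ 2)

/-! ### The stochastic integral of a deterministic function over `D = (0,1)` -/

/-- A complex step function `∑ i, c i • 1_{(a i, b i]}` with all intervals inside `[0,1]`. -/
structure StepFn where
  m : ℕ
  a : Fin m → ℝ
  b : Fin m → ℝ
  c : Fin m → ℂ
  zero_le : ∀ i, 0 ≤ a i
  a_le_b : ∀ i, a i ≤ b i
  le_one : ∀ i, b i ≤ 1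

/-- The function on `ℝ` given by a step function. -/
def StepFn.toFun (φ : StepFn) (y : ℝ) : ℂ :=
  ∑ i, Set.indicator (Set.Ioc (φ.a i) (φ.b i)) (fun _ => φ.c i) y

/-- The elementary integral `∑ i, c i (B(b i) - B(a i))` of a step function. -/
def StepFn.integral {Ω : Type*} (φ : StepFn) (B : ℝ → Ω → ℝ) (o : Ω) : ℂ :=
  ∑ i, φ.c i * ((B (φ.b i) o - B (φ.a i) o : ℝ) : ℂ)

/-- The zero extension of `g` outside `D = (0,1)`. -/
def zeroExt (g : ℝ → ℂ) : ℝ → ℂ := Set.indicator (Set.Ioo 0 1) g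

/-- `I` is (a version of) the stochastic integral `∫_D g(y) dB(y)` with respect to a fractional
Brownian motion `B` of Hurst index `H`: it is the mean square limit of the elementary integrals
of step functions that converge to the zero extension of `g` in the Sobolev norm of order
`1/2 - H` if `H < 1/2`, and in the `L²` norm (Sobolev norm of order `0`) if `H ≥ 1/2`. -/
def IsWienerIntegral {Ω : Type*} [MeasurableSpace Ω] (P : Measure Ω) (H : ℝ) (B : ℝ → Ω → ℝ)
    (g : ℝ → ℂ) (I : Ω → ℂ) : Prop :=
  MemLp (zeroExt g) 2 volume ∧ MemLp I 2 P ∧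
    ∃ φ : ℕ → StepFn,
      Tendsto (fun k => sobolevNormSq (max 0 (1 / 2 - H)) (fun y => (φ k).toFun y - zeroExt g y))
        atTop (𝓝 0) ∧
      Tendsto (fun k => eLpNorm (fun o => (φ k).integral B o - I o) 2 P) atTop (𝓝 0)

open Classical in
/-- The stochastic integral `∫_D g(y) dB(y)` (with the value `0` where it does not exist). -/
def wienerIntegral {Ω : Type*} [MeasurableSpace Ω] (P : Measure Ω) (H : ℝ) (B : ℝ → Ω → ℝ)
    (g : ℝ → ℂ) : Ω → ℂ :=
  if h : ∃ I, IsWienerIntegral P H B g I then h.choose else 0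

/-! ### The symbol of the time derivatives and the Green function -/

/-- `s = ∑ k, (iω)^{α k}` with principal values of the powers. -/
def symbol {N : ℕ} (α : Fin N → ℝ) (ω : ℝ) : ℂ :=
  ∑ k, (Complex.I * ω) ^ (α k : ℂ)

/-- The principal square root of `s`, with argument in `(-π/2, π/2]`. -/
def sqrtSymbol {N : ℕ} (α : Fin N → ℝ) (ω : ℝ) : ℂ := symbol α ω ^ (1 / 2 : ℂ)

/-- `α_max`, the largest of the orders that differ from `2`. -/
def alphaMax {N : ℕ} (α : Fin N → ℝ) : ℝ := sSup {a : ℝ | a ≠ 2 ∧ ∃ i, α i = a}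

/-- The Green function of `∂ₓₓ G - s G = δ(x - y)` on `(0,1)` with `∂ₓ G(0,y) = 0`,
`G(1,y) = 0`. -/
def green {N : ℕ} (α : Fin N → ℝ) (ω x y : ℝ) : ℂ :=
  if ω = 0 then ((max x y - 1 : ℝ) : ℂ)
  else
    (Complex.exp (sqrtSymbol α ω * (x + y)) + Complex.exp (sqrtSymbol α ω * |x - y|)
        - Complex.exp (sqrtSymbol α ω * (2 - x - y))
        - Complex.exp (sqrtSymbol α ω * (2 - |x - y|)))
      / (2 * sqrtSymbol α ω * (1 + Complex.exp (2 * sqrtSymbol α ω)))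

/-- `R(ω) = E |∫_D G_ω(0,y) dB(y)|²`. -/
def R {Ω : Type*} [MeasurableSpace Ω] (P : Measure Ω) (H : ℝ) (B : ℝ → Ω → ℝ)
    {N : ℕ} (α : Fin N → ℝ) (ω : ℝ) : ℝ :=
  ∫ o, ‖wienerIntegral P H B (green α ω 0) o‖ ^ 2 ∂P

/-! ### The boundary data -/

/-- The boundary value `û(0,ω) = -f̂(ω) ∫_D G_ω(0,y) dB(y)` of the mild solution in the
frequency domain, for the source function `f`. -/
def boundaryValue {Ω : Type*} [MeasurableSpace Ω] (P : Measure Ω) (H : ℝ) (B : ℝ → Ω → ℝ)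
    {N : ℕ} (α : Fin N → ℝ) (f : ℝ → ℝ) (ω : ℝ) (o : Ω) : ℂ :=
  -(fourierT (fun t => (f t : ℂ)) ω) * wienerIntegral P H B (green α ω 0) o

/-- The variance `E |X - E X|²` of a complex random variable. -/
def cVariance {Ω : Type*} [MeasurableSpace Ω] (P : Measure Ω) (X : Ω → ℂ) : ℝ :=
  ∫ o, ‖X o - ∫ o', X o' ∂P‖ ^ 2 ∂P

end FracDiffusionWave

end

noncomputable section

namespace FracDiffusionWave

/-! ### The spectral density of fractional Brownian motion -/

/-! The covariance of fractional Brownian motion is, up to the factor `2 * spectralConst H`, the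
Gram matrix of the functions `spectralFn H x` in L². Hence the second moment of an elementary
integral is a multiple of ∫ |ζ|^{1-2H} |φ̂(ζ)|² dζ (`integral_stepFn_integral_sq`,
`StepFn.norm_spectral_sq`). The weight is dominated by the Sobolev weight except near ζ = 0, where
|φ̂|² ≤ ‖φ‖² in L², because φ lives on (0,1]. So elementary integrals are controlled by the Sobolev
norm (`eLpNorm_stepFn_integral_sq_le`), which gives uniqueness, and existence by completeness once
approximating step functions are found; left-endpoint sums serve for C¹ functions.

For the decay, put z = √s. The terms of Im s all have the sign of ω, so they cannot cancel, and |Im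
s| ≤ 2 Re z |z| bounds both Re z |z| and |z|² from below by multiples of |ω|^{α_max}. Since
|G_ω(0,y)| ≤ (2 + 1/Re z)/|z| (`norm_greenTrace_le`), the sup norm squared is O(|ω|^{-α_max}), and
for H ≥ 1/2 the sup norm controls the integral. For H < 1/2 the total variation enters as well. It
is at most 1/Re z, and Re z → ∞ when all orders are below 2 (`sq_le_sqrtSymbol_re_sq`).

Instability: the variance of the data is |f̂(ω)|² times a factor at most 4 R(ω) → 0, so a
perturbation with |φ̂(ω)| of fixed large size is invisible at high frequency. -/

theorem integrable_abs_rpow_indicator {r : ℝ} (hr : -1 < r) :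
    Integrable (Set.indicator (Set.Icc (-1) 1) fun ζ : ℝ => |ζ| ^ r) := by
  rw [integrable_indicator_iff measurableSet_Icc]
  have h1 : IntegrableOn (fun ζ : ℝ => |ζ| ^ r) (Set.Ioc 0 1) := by
    have := (intervalIntegral.intervalIntegrable_rpow' (a := 0) (b := 1) hr).1
    refine this.congr_fun (fun x hx => ?_) measurableSet_Ioc
    simp only [abs_of_pos hx.1]
  have h2 : IntegrableOn (fun ζ : ℝ => |ζ| ^ r) (Set.Ico (-1) 0) := by
    have h := (integrable_indicator_iff measurableSet_Ioc).2 h1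
    have h' := h.comp_neg
    rw [← integrable_indicator_iff measurableSet_Ico]
    refine h'.congr (ae_of_all _ fun x => ?_)
    by_cases hx : x ∈ Set.Ico (-1 : ℝ) 0
    · have : -x ∈ Set.Ioc (0 : ℝ) 1 := ⟨by linarith [hx.2], by linarith [hx.1]⟩
      simp [Set.indicator_of_mem hx, Set.indicator_of_mem this]
    · have : -x ∉ Set.Ioc (0 : ℝ) 1 := fun h => hx ⟨by linarith [h.2], by linarith [h.1]⟩
      simp [Set.indicator_of_notMem hx, Set.indicator_of_notMem this]
  have h3 : IntegrableOn (fun ζ : ℝ => |ζ| ^ r) {(0 : ℝ)} := by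
    simp [IntegrableOn, Measure.restrict_eq_zero.2]
  refine ((h1.union h2).union h3).mono_set fun x hx => ?_
  rcases lt_trichotomy x 0 with h | h | h
  · exact Or.inl (Or.inr ⟨hx.1, h⟩)
  · exact Or.inr h
  · exact Or.inl (Or.inl ⟨h, hx.2⟩)

/-- Outside [-1,1] the exponents compare, since 1 - 2H ≤ 2 max(0, 1/2 - H). The indicator is needed
because for H > 1/2 the left side is singular at 0. -/
theorem abs_rpow_le_sobolev_weight (H ζ : ℝ) :
    |ζ| ^ (1 - 2 * H) ≤ (1 + ζ ^ 2) ^ max 0 (1 / 2 - H)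
      + Set.indicator (Set.Icc (-1) 1) (fun ζ : ℝ => |ζ| ^ (1 - 2 * H)) ζ := by
  by_cases hζ : ζ ∈ Set.Icc (-1 : ℝ) 1
  · rw [Set.indicator_of_mem hζ]
    have : 0 ≤ (1 + ζ ^ 2) ^ max 0 (1 / 2 - H) := by positivity
    linarith
  · rw [Set.indicator_of_notMem hζ, add_zero]
    have h1 : 1 < |ζ| := by
      by_contra h
      exact hζ (abs_le.1 (not_lt.1 h))
    have h2 : |ζ| ^ (2 : ℝ) ≤ 1 + ζ ^ 2 := by
      rw [Real.rpow_two, sq_abs]; linarith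
    calc |ζ| ^ (1 - 2 * H) ≤ |ζ| ^ (2 * max 0 (1 / 2 - H)) :=
          Real.rpow_le_rpow_of_exponent_le h1.le (by linarith [le_max_right 0 (1 / 2 - H)])
      _ = (|ζ| ^ (2 : ℝ)) ^ max 0 (1 / 2 - H) := Real.rpow_mul (abs_nonneg _) _ _
      _ ≤ _ := Real.rpow_le_rpow (by positivity) h2 (le_max_left _ _)

/-- The decay order 2 - 2γ exceeds 1. For γ = max(0, 1/2 - H) this is where H > 0 enters: functions
with jumps, whose transform is only O(1/ζ), still have finite Sobolev norm. -/
theorem integrable_one_add_sq_rpow {γ : ℝ} (hγ : γ < 1 / 2) :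
    Integrable fun ζ : ℝ => (1 + ζ ^ 2) ^ γ * (1 + ζ ^ 2)⁻¹ := by
  have h := integrable_rpow_neg_one_add_norm_sq (E := ℝ) (μ := volume) (r := 2 - 2 * γ)
    (by simp; linarith)
  refine h.congr (ae_of_all _ fun ζ => ?_)
  have : (0 : ℝ) < 1 + ζ ^ 2 := by positivity
  simp only [Real.norm_eq_abs, sq_abs]
  rw [← Real.rpow_neg_one, ← Real.rpow_add this]
  congr 1; ring

theorem sobolev_order_lt {H : ℝ} (hH0 : 0 < H) : max 0 (1 / 2 - H) < 1 / 2 :=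
  max_lt (by norm_num) (by linarith)

theorem measurable_abs_rpow (r : ℝ) : Measurable fun ζ : ℝ => |ζ| ^ r := by fun_prop

theorem integrable_abs_rpow_div {H : ℝ} (hH0 : 0 < H) (hH1 : H < 1) :
    Integrable fun ζ : ℝ => |ζ| ^ (1 - 2 * H) * (1 + ζ ^ 2)⁻¹ := by
  refine ((integrable_one_add_sq_rpow (sobolev_order_lt hH0)).add
    (integrable_abs_rpow_indicator (r := 1 - 2 * H) (by linarith))).mono'
    ((measurable_abs_rpow _).mul (by fun_prop)).aestronglyMeasurable (ae_of_all _ fun ζ => ?_)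
  have h0 : (0 : ℝ) < 1 + ζ ^ 2 := by positivity
  rw [Real.norm_of_nonneg (by positivity), Pi.add_apply]
  have h1 := mul_le_mul_of_nonneg_right (abs_rpow_le_sobolev_weight H ζ) (inv_nonneg.2 h0.le)
  refine h1.trans ?_
  rw [add_mul]
  refine add_le_add le_rfl (mul_le_of_le_one_right ?_ (inv_le_one_of_one_le₀ (by nlinarith)))
  exact Set.indicator_nonneg (fun _ _ => by positivity) _

theorem one_sub_cos_mul_le {H x ζ : ℝ} (hζ : ζ ≠ 0) :
    (1 - Real.cos (x * ζ)) * |ζ| ^ (-1 - 2 * H)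
      ≤ (x ^ 2 / 2 + 2) * (|ζ| ^ (1 - 2 * H) * (1 + ζ ^ 2)⁻¹) := by
  have h0 : (0 : ℝ) < 1 + ζ ^ 2 := by positivity
  have ha : 0 < |ζ| := abs_pos.2 hζ
  -- Adds 1 - cos t ≤ t²/2, sharp near 0, to ζ² times 1 - cos t ≤ 2, the useful bound at infinity.
  have h1 : (1 - Real.cos (x * ζ)) * (1 + ζ ^ 2) ≤ (x ^ 2 / 2 + 2) * ζ ^ 2 := by
    have := Real.one_sub_sq_div_two_le_cos (x := x * ζ)
    have := Real.neg_one_le_cos (x * ζ)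
    nlinarith [sq_nonneg ζ]
  have h2 : |ζ| ^ (1 - 2 * H) = |ζ| ^ (-1 - 2 * H) * ζ ^ 2 := by
    rw [← sq_abs, ← Real.rpow_two, ← Real.rpow_add ha]; congr 1; ring
  rw [h2]
  have h3 : 0 ≤ |ζ| ^ (-1 - 2 * H) := by positivity
  have h4 : (1 - Real.cos (x * ζ)) ≤ (x ^ 2 / 2 + 2) * ζ ^ 2 * (1 + ζ ^ 2)⁻¹ := by
    rw [← div_eq_mul_inv, le_div_iff₀ h0]; exact h1
  nlinarith [mul_le_mul_of_nonneg_right h4 h3]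

theorem integrable_one_sub_cos {H : ℝ} (hH0 : 0 < H) (hH1 : H < 1) (x : ℝ) :
    Integrable fun ζ : ℝ => (1 - Real.cos (x * ζ)) * |ζ| ^ (-1 - 2 * H) := by
  refine ((integrable_abs_rpow_div hH0 hH1).const_mul (x ^ 2 / 2 + 2)).mono'
    ((by fun_prop : Measurable fun ζ : ℝ => 1 - Real.cos (x * ζ)).mul
      (measurable_abs_rpow _)).aestronglyMeasurable ?_
  filter_upwards [Measure.ae_ne volume (0 : ℝ)] with ζ hζ
  have := Real.cos_le_one (x * ζ)
  rw [Real.norm_of_nonneg (mul_nonneg (by linarith) (by positivity))]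
  exact one_sub_cos_mul_le hζ

/-- The normalizing constant `∫ (1 - cos ζ) |ζ|^{-1-2H} dζ` of the spectral density. -/
def spectralConst (H : ℝ) : ℝ := ∫ ζ : ℝ, (1 - Real.cos ζ) * |ζ| ^ (-1 - 2 * H)

theorem spectralConst_pos {H : ℝ} (hH0 : 0 < H) (hH1 : H < 1) : 0 < spectralConst H := by
  have hi : Integrable fun ζ : ℝ => (1 - Real.cos ζ) * |ζ| ^ (-1 - 2 * H) := by
    simpa using integrable_one_sub_cos hH0 hH1 1
  have hnn : ∀ ζ : ℝ, 0 ≤ (1 - Real.cos ζ) * |ζ| ^ (-1 - 2 * H) := fun ζ =>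
    mul_nonneg (by linarith [Real.cos_le_one ζ]) (by positivity)
  rw [spectralConst, integral_pos_iff_support_of_nonneg hnn hi]
  have hsub : Set.Ioo (0 : ℝ) 1 ⊆
      Function.support fun ζ : ℝ => (1 - Real.cos ζ) * |ζ| ^ (-1 - 2 * H) := by
    intro ζ hζ
    have hc : Real.cos ζ < 1 := by
      have := Real.cos_lt_cos_of_nonneg_of_le_pi (x := 0) (y := ζ) le_rfl
        (by linarith [Real.pi_gt_three, hζ.2]) hζ.1
      simpa using this
    have : 0 < |ζ| ^ (-1 - 2 * H) := Real.rpow_pos_of_pos (abs_pos.2 hζ.1.ne') _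
    exact (mul_pos (by linarith) this).ne'
  refine lt_of_lt_of_le ?_ (measure_mono hsub)
  simp

/-- Scaling ζ ↦ xζ: the power weight contributes |x|^{1+2H} and the Jacobian |x|⁻¹. -/
theorem integral_one_sub_cos {H : ℝ} (hH0 : 0 < H) (x : ℝ) :
    ∫ ζ : ℝ, (1 - Real.cos (x * ζ)) * |ζ| ^ (-1 - 2 * H)
      = spectralConst H * |x| ^ (2 * H) := by
  rcases eq_or_ne x 0 with rfl | hx
  · simp [Real.zero_rpow (by linarith : 2 * H ≠ 0)]
  have ha : 0 < |x| := abs_pos.2 hx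
  have h := Measure.integral_comp_mul_left
    (fun ζ : ℝ => (1 - Real.cos ζ) * |ζ| ^ (-1 - 2 * H)) x
  have h1 : ∀ ζ : ℝ, (1 - Real.cos (x * ζ)) * |ζ| ^ (-1 - 2 * H)
      = |x| ^ (1 + 2 * H) * ((1 - Real.cos (x * ζ)) * |x * ζ| ^ (-1 - 2 * H)) := by
    intro ζ
    rw [abs_mul, Real.mul_rpow (abs_nonneg _) (abs_nonneg _)]
    have : |x| ^ (1 + 2 * H) * |x| ^ (-1 - 2 * H) = 1 := by
      rw [← Real.rpow_add ha]; simp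
    linear_combination (-((1 - Real.cos (x * ζ)) * |ζ| ^ (-1 - 2 * H))) * this
  simp_rw [h1]
  rw [integral_const_mul, h, smul_eq_mul, ← spectralConst, abs_inv, Real.rpow_add ha,
    Real.rpow_one]
  field_simp

/-- The weighted exponential `(e^{-iζx} - 1) |ζ|^{-1/2-H}` representing `B(x)`. -/
def spectralFn (H x ζ : ℝ) : ℂ :=
  (Complex.exp (-(Complex.I * ζ * x)) - 1) * ((|ζ| ^ (-1 / 2 - H) : ℝ) : ℂ)

theorem measurable_spectralFn (H x : ℝ) : Measurable (spectralFn H x) := by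
  unfold spectralFn
  exact (by fun_prop : Measurable fun ζ : ℝ => Complex.exp (-(Complex.I * ζ * x)) - 1).mul
    (Complex.measurable_ofReal.comp (measurable_abs_rpow _))

theorem abs_rpow_half_sq (H ζ : ℝ) :
    |ζ| ^ (-1 / 2 - H) * |ζ| ^ (-1 / 2 - H) = |ζ| ^ (-1 - 2 * H) := by
  rw [← sq, ← Real.rpow_natCast, ← Real.rpow_mul (abs_nonneg _)]
  congr 1; push_cast; ring

theorem spectralFn_mul_conj (H x y ζ : ℝ) :
    spectralFn H x ζ * (starRingEnd ℂ) (spectralFn H y ζ)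
      = (Complex.exp (-(Complex.I * ζ * ((x - y : ℝ) : ℂ))) - Complex.exp (-(Complex.I * ζ * x))
          - Complex.exp (Complex.I * ζ * y) + 1) * ((|ζ| ^ (-1 - 2 * H) : ℝ) : ℂ) := by
  unfold spectralFn
  rw [← abs_rpow_half_sq]
  simp only [map_mul, map_sub, ← Complex.exp_conj, map_neg, Complex.conj_I, Complex.conj_ofReal,
    map_one]
  have : Complex.exp (-(Complex.I * ζ * ((x - y : ℝ) : ℂ)))
      = Complex.exp (-(Complex.I * ζ * x)) * Complex.exp (-(-Complex.I * ζ * y)) := by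
    rw [← Complex.exp_add]; congr 1; push_cast; ring
  rw [this, show Complex.exp (Complex.I * ζ * y) = Complex.exp (-(-Complex.I * ζ * y)) by
    congr 1; ring]
  push_cast
  ring

theorem re_spectralFn_mul_conj (H x y ζ : ℝ) :
    (spectralFn H x ζ * (starRingEnd ℂ) (spectralFn H y ζ)).re
      = (1 - Real.cos (x * ζ)) * |ζ| ^ (-1 - 2 * H) + (1 - Real.cos (y * ζ)) * |ζ| ^ (-1 - 2 * H)
        - (1 - Real.cos ((x - y) * ζ)) * |ζ| ^ (-1 - 2 * H) := by
  have h : ∀ t : ℝ, (Complex.exp (-(Complex.I * ζ * t))).re = Real.cos (t * ζ) := by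
    intro t
    rw [show -(Complex.I * ζ * t) = ((-(t * ζ) : ℝ) : ℂ) * Complex.I by push_cast; ring,
      Complex.exp_ofReal_mul_I_re, Real.cos_neg]
  have h' : (Complex.exp (Complex.I * ζ * y)).re = Real.cos (y * ζ) := by
    rw [show Complex.I * ζ * y = ((y * ζ : ℝ) : ℂ) * Complex.I by push_cast; ring,
      Complex.exp_ofReal_mul_I_re]
  rw [spectralFn_mul_conj, Complex.re_mul_ofReal]
  simp only [Complex.add_re, Complex.sub_re, Complex.one_re, h, h']
  ring

theorem memLp_spectralFn {H : ℝ} (hH0 : 0 < H) (hH1 : H < 1) (x : ℝ) :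
    MemLp (spectralFn H x) 2 := by
  rw [memLp_two_iff_integrable_sq_norm (measurable_spectralFn H x).aestronglyMeasurable]
  refine ((integrable_one_sub_cos hH0 hH1 x).const_mul 2).congr (ae_of_all _ fun ζ => ?_)
  have h := re_spectralFn_mul_conj H x x ζ
  rw [Complex.mul_conj, Complex.ofReal_re, Complex.normSq_eq_norm_sq] at h
  simp only [h, sub_self, zero_mul, Real.cos_zero]
  ring

/-- The real part is a combination of three integrals of type 1 - cos. The imaginary part vanishes
because ζ ↦ -ζ conjugates the integrand. -/
theorem integral_spectralFn_mul_conj {H : ℝ} (hH0 : 0 < H) (hH1 : H < 1) (x y : ℝ) :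
    ∫ ζ, spectralFn H x ζ * (starRingEnd ℂ) (spectralFn H y ζ)
      = ((spectralConst H * (|x| ^ (2 * H) + |y| ^ (2 * H) - |x - y| ^ (2 * H)) : ℝ) : ℂ) := by
  have hint : Integrable fun ζ => spectralFn H x ζ * (starRingEnd ℂ) (spectralFn H y ζ) :=
    (memLp_spectralFn hH0 hH1 x).integrable_mul (memLp_spectralFn hH0 hH1 y).star
  have hre : (∫ ζ, spectralFn H x ζ * (starRingEnd ℂ) (spectralFn H y ζ)).re
      = spectralConst H * (|x| ^ (2 * H) + |y| ^ (2 * H) - |x - y| ^ (2 * H)) := by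
    have h := integral_re hint
    simp only [RCLike.re_to_complex] at h
    rw [← h]
    simp_rw [re_spectralFn_mul_conj]
    have hxy : Integrable fun ζ : ℝ => (1 - Real.cos (x * ζ)) * |ζ| ^ (-1 - 2 * H)
        + (1 - Real.cos (y * ζ)) * |ζ| ^ (-1 - 2 * H) :=
      (integrable_one_sub_cos hH0 hH1 x).add (integrable_one_sub_cos hH0 hH1 y)
    rw [integral_sub hxy
      (integrable_one_sub_cos hH0 hH1 _), integral_add (integrable_one_sub_cos hH0 hH1 x)
      (integrable_one_sub_cos hH0 hH1 y), integral_one_sub_cos hH0, integral_one_sub_cos hH0,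
      integral_one_sub_cos hH0]
    ring
  have hodd : ∀ x ζ, spectralFn H x (-ζ) = (starRingEnd ℂ) (spectralFn H x ζ) := by
    intro x ζ
    simp only [spectralFn, map_mul, map_sub, ← Complex.exp_conj, map_neg, Complex.conj_I,
      Complex.conj_ofReal, map_one, abs_neg]
    congr 3
    push_cast; ring
  have him : (starRingEnd ℂ) (∫ ζ, spectralFn H x ζ * (starRingEnd ℂ) (spectralFn H y ζ))
      = ∫ ζ, spectralFn H x ζ * (starRingEnd ℂ) (spectralFn H y ζ) := by
    rw [← integral_conj, ← integral_neg_eq_self]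
    simp only [hodd, map_mul, Complex.conj_conj]
  rw [← hre]
  exact (Complex.conj_eq_iff_re.1 him).symm

/-! ### Isometries determined by Gram matrices -/

theorem integral_norm_sum_sq {A ι : Type*} [MeasurableSpace A] {μ : Measure A} [Fintype ι]
    {X : ι → A → ℂ} (hX : ∀ i, MemLp (X i) 2 μ) (c : ι → ℂ) :
    ((∫ a, ‖∑ i, c i * X i a‖ ^ 2 ∂μ : ℝ) : ℂ)
      = ∑ i, ∑ j, c i * (starRingEnd ℂ) (c j) * ∫ a, X i a * (starRingEnd ℂ) (X j a) ∂μ := by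
  have hint : ∀ i j, Integrable (fun a => X i a * (starRingEnd ℂ) (X j a)) μ := fun i j =>
    (hX i).integrable_mul (hX j).star
  have h : ∀ a, ((‖∑ i, c i * X i a‖ ^ 2 : ℝ) : ℂ)
      = ∑ i, ∑ j, c i * (starRingEnd ℂ) (c j) * (X i a * (starRingEnd ℂ) (X j a)) := by
    intro a
    rw [← Complex.normSq_eq_norm_sq, ← Complex.mul_conj, map_sum, Finset.sum_mul_sum]
    refine Finset.sum_congr rfl fun i _ => Finset.sum_congr rfl fun j _ => ?_
    rw [map_mul]; ring
  rw [← integral_complex_ofReal]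
  simp_rw [h]
  rw [integral_finsetSum _ fun i _ => integrable_finsetSum _ fun j _ => (hint i j).const_mul _]
  refine Finset.sum_congr rfl fun i _ => ?_
  rw [integral_finsetSum _ fun j _ => (hint i j).const_mul _]
  exact Finset.sum_congr rfl fun j _ => integral_const_mul _ _

/-- The L² norm of a linear combination depends on the family only through its Gram matrix, so
proportional Gram matrices give a scaled isometry between the spans. -/
theorem integral_norm_sum_sq_eq_of_gram {A A' ι : Type*} [MeasurableSpace A] [MeasurableSpace A']
    {μ : Measure A} {ν : Measure A'} [Fintype ι] {X : ι → A → ℂ} {Y : ι → A' → ℂ}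
    (hX : ∀ i, MemLp (X i) 2 μ) (hY : ∀ i, MemLp (Y i) 2 ν) (κ : ℝ)
    (h : ∀ i j, ∫ a, X i a * (starRingEnd ℂ) (X j a) ∂μ
      = κ * ∫ a, Y i a * (starRingEnd ℂ) (Y j a) ∂ν) (c : ι → ℂ) :
    ∫ a, ‖∑ i, c i * X i a‖ ^ 2 ∂μ = κ * ∫ a, ‖∑ i, c i * Y i a‖ ^ 2 ∂ν := by
  have h1 := integral_norm_sum_sq hX c
  have h2 := integral_norm_sum_sq hY c
  apply Complex.ofReal_injective
  rw [h1, Complex.ofReal_mul, h2, Finset.mul_sum]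
  refine Finset.sum_congr rfl fun i _ => ?_
  rw [Finset.mul_sum]
  refine Finset.sum_congr rfl fun j _ => ?_
  rw [h]; ring

/-- The increment form of `integral_norm_sum_sq_eq_of_gram` for families indexed by `[0,1]`. -/
theorem integral_norm_sum_increments_sq_eq {A A' : Type*} [MeasurableSpace A]
    [MeasurableSpace A'] {μ : Measure A} {ν : Measure A'} {X : ℝ → A → ℂ} {Y : ℝ → A' → ℂ}
    (hX : ∀ x, MemLp (X x) 2 μ) (hY : ∀ x, MemLp (Y x) 2 ν) (κ : ℝ)
    (h : ∀ x ∈ Set.Icc (0 : ℝ) 1, ∀ y ∈ Set.Icc (0 : ℝ) 1,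
      ∫ a, X x a * (starRingEnd ℂ) (X y a) ∂μ = κ * ∫ a, Y x a * (starRingEnd ℂ) (Y y a) ∂ν)
    (φ : StepFn) :
    ∫ a, ‖∑ i, φ.c i * (X (φ.b i) a - X (φ.a i) a)‖ ^ 2 ∂μ
      = κ * ∫ a, ‖∑ i, φ.c i * (Y (φ.b i) a - Y (φ.a i) a)‖ ^ 2 ∂ν := by
  -- Increments are linear combinations over the doubled index set: right endpoints with weight c,
  -- left endpoints with weight -c.
  have key := integral_norm_sum_sq_eq_of_gram
    (X := fun i : Fin φ.m ⊕ Fin φ.m => X (Sum.elim φ.b φ.a i))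
    (Y := fun i : Fin φ.m ⊕ Fin φ.m => Y (Sum.elim φ.b φ.a i)) (fun i => hX _) (fun i => hY _) κ
    (fun i j => by
      have hm : ∀ i : Fin φ.m ⊕ Fin φ.m, Sum.elim φ.b φ.a i ∈ Set.Icc (0 : ℝ) 1 := by
        rintro (i | i)
        · exact ⟨(φ.zero_le i).trans (φ.a_le_b i), φ.le_one i⟩
        · exact ⟨φ.zero_le i, (φ.a_le_b i).trans (φ.le_one i)⟩
      exact h _ (hm i) _ (hm j)) (Sum.elim φ.c fun i => -φ.c i)
  simpa only [Fintype.sum_sum_type, Sum.elim_inl, Sum.elim_inr, mul_sub, Finset.sum_sub_distrib,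
    neg_mul, Finset.sum_neg_distrib, ← sub_eq_add_neg] using key

/-! ### Spectral representation of elementary integrals -/

/-- The spectral density of an elementary integral, before taking the squared modulus. -/
def StepFn.spectral (φ : StepFn) (H ζ : ℝ) : ℂ :=
  ∑ i, φ.c i * (spectralFn H (φ.b i) ζ - spectralFn H (φ.a i) ζ)

theorem IsFBM.memLp {Ω : Type*} [MeasurableSpace Ω] {P : Measure Ω} {H : ℝ} {B : ℝ → Ω → ℝ}
    (hB : IsFBM P H B) (x : ℝ) : MemLp (fun o => (B x o : ℂ)) 2 P :=
  (hB.gaussian.hasGaussianLaw_eval x).memLp_two.ofReal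

theorem memLp_stepFn_integral {Ω : Type*} [MeasurableSpace Ω] {P : Measure Ω} {H : ℝ}
    {B : ℝ → Ω → ℝ} (hB : IsFBM P H B) (φ : StepFn) : MemLp (φ.integral B) 2 P := by
  unfold StepFn.integral
  refine memLp_finsetSum _ fun i _ => MemLp.const_mul ?_ _
  simp only [Complex.ofReal_sub]
  exact (hB.memLp _).sub (hB.memLp _)

theorem integral_stepFn_integral_sq {Ω : Type*} [MeasurableSpace Ω] {P : Measure Ω} {H : ℝ}
    {B : ℝ → Ω → ℝ} (hH0 : 0 < H) (hH1 : H < 1) (hB : IsFBM P H B) (φ : StepFn) :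
    ∫ o, ‖φ.integral B o‖ ^ 2 ∂P = (2 * spectralConst H)⁻¹ * ∫ ζ, ‖φ.spectral H ζ‖ ^ 2 := by
  have hK := spectralConst_pos hH0 hH1
  have h := integral_norm_sum_increments_sq_eq (X := fun x o => (B x o : ℂ)) (Y := spectralFn H)
    hB.memLp (memLp_spectralFn hH0 hH1) (2 * spectralConst H)⁻¹
    (fun x _ y _ => by
      rw [integral_spectralFn_mul_conj hH0 hH1]
      simp only [Complex.conj_ofReal, ← Complex.ofReal_mul]
      rw [integral_complex_ofReal, hB.cov]
      congr 1
      field_simp) φ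
  simpa only [StepFn.integral, StepFn.spectral, Complex.ofReal_sub] using h

/-- Presents a step function as a sum of increments of x ↦ 1_{(0,x]}, so that this family can play
the role of B in the isometry. -/
theorem StepFn.toFun_eq_sum_sub (φ : StepFn) (y : ℝ) :
    φ.toFun y = ∑ i, φ.c i * (Set.indicator (Set.Ioc 0 (φ.b i)) (fun _ => (1 : ℂ)) y
      - Set.indicator (Set.Ioc 0 (φ.a i)) (fun _ => (1 : ℂ)) y) := by
  refine Finset.sum_congr rfl fun i _ => ?_
  have h1 := φ.zero_le i
  have h2 := φ.a_le_b i
  simp only [Set.indicator_apply, Set.mem_Ioc]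
  split_ifs <;> grind

theorem memLp_stepFn_toFun (φ : StepFn) : MemLp φ.toFun 2 := by
  unfold StepFn.toFun
  refine memLp_finsetSum _ fun i _ => ?_
  exact memLp_indicator_const 2 measurableSet_Ioc _ (Or.inr (by simp))

/-- Plancherel's theorem for step functions. -/
theorem integral_stepFn_toFun_sq (φ : StepFn) :
    ∫ y, ‖φ.toFun y‖ ^ 2
      = (2 * spectralConst (1 / 2))⁻¹ * ∫ ζ, ‖φ.spectral (1 / 2) ζ‖ ^ 2 := by
  have hH0 : (0 : ℝ) < 1 / 2 := by norm_num
  have hH1 : (1 / 2 : ℝ) < 1 := by norm_num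
  have hK := spectralConst_pos hH0 hH1
  have h := integral_norm_sum_increments_sq_eq
    (X := fun x => Set.indicator (Set.Ioc 0 x) (fun _ => (1 : ℂ))) (Y := spectralFn (1 / 2))
    (fun x => memLp_indicator_const (μ := volume) 2 measurableSet_Ioc _ (Or.inr (by simp)))
    (memLp_spectralFn hH0 hH1) (2 * spectralConst (1 / 2))⁻¹
    (fun x hx y hy => by
      rw [integral_spectralFn_mul_conj hH0 hH1]
      have : ∀ t : ℝ, Set.indicator (Set.Ioc 0 x) (fun _ => (1 : ℂ)) t
          * (starRingEnd ℂ) (Set.indicator (Set.Ioc 0 y) (fun _ => (1 : ℂ)) t)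
          = Set.indicator (Set.Ioc 0 (min x y)) (fun _ => (1 : ℂ)) t := by
        intro t
        simp only [Set.indicator_apply, Set.mem_Ioc, le_min_iff]
        split_ifs <;> first | (simp; done) | grind
      simp_rw [this]
      rw [integral_indicator_const _ measurableSet_Ioc, Real.volume_real_Ioc_of_le
        (le_min hx.1 hy.1), Complex.real_smul, mul_one, ← Complex.ofReal_mul]
      congr 1
      -- At H = 1/2 the covariance (x + y - |x - y|)/2 is min x y, the inner product of the two
      -- indicators; this uses x, y ≥ 0.
      rw [show 2 * (1 / 2 : ℝ) = 1 by norm_num, Real.rpow_one, Real.rpow_one, Real.rpow_one,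
        abs_of_nonneg hx.1, abs_of_nonneg hy.1]
      field_simp
      rcases le_total x y with h | h
      · rw [min_eq_left h, abs_of_nonpos (by linarith)]; ring
      · rw [min_eq_right h, abs_of_nonneg (by linarith)]; ring) φ
  simp_rw [StepFn.toFun_eq_sum_sub]
  exact h

theorem memLp_stepFn_spectral {H : ℝ} (hH0 : 0 < H) (hH1 : H < 1) (φ : StepFn) :
    MemLp (φ.spectral H) 2 := by
  unfold StepFn.spectral
  exact memLp_finsetSum _ fun i _ =>
    ((memLp_spectralFn hH0 hH1 _).sub (memLp_spectralFn hH0 hH1 _)).const_mul _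

/-- Stated without dividing by ζ, so that ζ = 0 is included. -/
theorem fourierT_indicator_const {a b : ℝ} (hab : a ≤ b) (c : ℂ) (ζ : ℝ) :
    -(Complex.I * ζ) * fourierT (Set.indicator (Set.Ioc a b) fun _ => c) ζ
      = c * (Complex.exp (-(Complex.I * ζ * b)) - Complex.exp (-(Complex.I * ζ * a))) := by
  unfold fourierT
  have h : ∀ t : ℝ, Set.indicator (Set.Ioc a b) (fun _ => c) t
      * Complex.exp (-(Complex.I * ζ * t))
      = Set.indicator (Set.Ioc a b) (fun t : ℝ => c * Complex.exp (-(Complex.I * ζ * t))) t := by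
    intro t
    simp only [Set.indicator_apply]
    split_ifs <;> simp
  simp_rw [h]
  rw [integral_indicator measurableSet_Ioc, ← intervalIntegral.integral_of_le hab,
    intervalIntegral.integral_const_mul]
  rcases eq_or_ne ζ 0 with rfl | hζ
  · simp
  have hne : -(Complex.I * ζ) ≠ 0 := by simp [hζ]
  have := integral_exp_mul_complex (a := a) (b := b) hne
  simp only [neg_mul] at this ⊢
  rw [this]
  have hζ' : (ζ : ℂ) ≠ 0 := by exact_mod_cast hζ
  field_simp

theorem integrable_stepFn_term (φ : StepFn) (i : Fin φ.m) (ζ : ℝ) :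
    Integrable fun t : ℝ => Set.indicator (Set.Ioc (φ.a i) (φ.b i)) (fun _ => φ.c i) t
      * Complex.exp (-(Complex.I * ζ * t)) := by
  have h : Integrable (Set.indicator (Set.Ioc (φ.a i) (φ.b i)) (fun _ => φ.c i)) := by
    rw [integrable_indicator_iff measurableSet_Ioc]
    exact integrableOn_const (by simp)
  refine h.mul_bdd (c := 1) (by fun_prop) (ae_of_all _ fun t => ?_)
  rw [show -(Complex.I * ζ * t) = ((-(ζ * t) : ℝ) : ℂ) * Complex.I by push_cast; ring,
    Complex.norm_exp_ofReal_mul_I]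

theorem StepFn.fourierT_toFun (φ : StepFn) (ζ : ℝ) :
    fourierT φ.toFun ζ
      = ∑ i, fourierT (Set.indicator (Set.Ioc (φ.a i) (φ.b i)) fun _ => φ.c i) ζ := by
  unfold fourierT StepFn.toFun
  simp_rw [Finset.sum_mul]
  exact integral_finsetSum _ fun i _ => integrable_stepFn_term φ i ζ

theorem StepFn.spectral_eq (φ : StepFn) (H ζ : ℝ) :
    φ.spectral H ζ
      = -(Complex.I * ζ) * fourierT φ.toFun ζ * ((|ζ| ^ (-1 / 2 - H) : ℝ) : ℂ) := by
  rw [φ.fourierT_toFun, Finset.mul_sum, Finset.sum_mul]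
  refine Finset.sum_congr rfl fun i _ => ?_
  rw [fourierT_indicator_const (φ.a_le_b i)]
  unfold spectralFn
  ring

/-- The factor ζ² from differentiation meets |ζ|^{-1-2H}. The point 0 is excluded because at H = 1/2
the right side reads 0⁰ there. -/
theorem StepFn.norm_spectral_sq (φ : StepFn) (H : ℝ) {ζ : ℝ} (hζ : ζ ≠ 0) :
    ‖φ.spectral H ζ‖ ^ 2 = |ζ| ^ (1 - 2 * H) * ‖fourierT φ.toFun ζ‖ ^ 2 := by
  have ha : 0 < |ζ| := abs_pos.2 hζ
  rw [φ.spectral_eq, norm_mul, norm_mul, norm_neg, norm_mul, Complex.norm_I, one_mul,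
    Complex.norm_real, Complex.norm_real, Real.norm_eq_abs, Real.norm_of_nonneg (by positivity)]
  have : |ζ| ^ (1 - 2 * H) = (|ζ| * |ζ| ^ (-1 / 2 - H)) ^ 2 := by
    rw [mul_pow, sq (|ζ| ^ (-1 / 2 - H)), abs_rpow_half_sq, ← Real.rpow_two, ← Real.rpow_add ha]
    congr 1; ring
  rw [this]; ring

/-! ### Elementary integrals are bounded by the Sobolev norm -/

theorem sq_integral_le_integral_sq {A : Type*} [MeasurableSpace A] {μ : Measure A}
    [IsProbabilityMeasure μ] {f : A → ℝ} (hf : MemLp f 2 μ) :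
    (∫ a, f a ∂μ) ^ 2 ≤ ∫ a, f a ^ 2 ∂μ := by
  have h := variance_nonneg f μ
  rw [variance_eq_sub hf] at h
  simpa using h

theorem norm_exp_neg_I_mul (ζ t : ℝ) : ‖Complex.exp (-(Complex.I * ζ * t))‖ = 1 := by
  rw [show -(Complex.I * ζ * t) = ((-(ζ * t) : ℝ) : ℂ) * Complex.I by push_cast; ring,
    Complex.norm_exp_ofReal_mul_I]

theorem norm_fourierT_le (v : ℝ → ℂ) (ζ : ℝ) : ‖fourierT v ζ‖ ≤ ∫ t, ‖v t‖ := by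
  refine (norm_integral_le_integral_norm _).trans_eq ?_
  simp only [norm_mul, norm_exp_neg_I_mul, mul_one]

theorem StepFn.toFun_eq_zero (φ : StepFn) {y : ℝ} (hy : y ∉ Set.Ioc (0 : ℝ) 1) :
    φ.toFun y = 0 :=
  Finset.sum_eq_zero fun i _ => Set.indicator_of_notMem
    (fun h => hy ⟨(φ.zero_le i).trans_lt h.1, h.2.trans (φ.le_one i)⟩) _

/-- The transform is bounded by the L¹ norm, and on a set of measure 1 the L¹ norm is at most the L²
norm. -/
theorem StepFn.norm_fourierT_sq_le (φ : StepFn) (ζ : ℝ) :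
    ‖fourierT φ.toFun ζ‖ ^ 2 ≤ ∫ y, ‖φ.toFun y‖ ^ 2 := by
  have : IsProbabilityMeasure (volume.restrict (Set.Ioc (0 : ℝ) 1)) := ⟨by simp⟩
  have h1 : ∫ y, ‖φ.toFun y‖ = ∫ y in Set.Ioc (0 : ℝ) 1, ‖φ.toFun y‖ :=
    (setIntegral_eq_integral_of_forall_compl_eq_zero fun y hy => by
      simp [φ.toFun_eq_zero hy]).symm
  have h2 : ∫ y, ‖φ.toFun y‖ ^ 2 = ∫ y in Set.Ioc (0 : ℝ) 1, ‖φ.toFun y‖ ^ 2 :=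
    (setIntegral_eq_integral_of_forall_compl_eq_zero fun y hy => by
      simp [φ.toFun_eq_zero hy]).symm
  calc ‖fourierT φ.toFun ζ‖ ^ 2 ≤ (∫ y, ‖φ.toFun y‖) ^ 2 := by
        gcongr; exact norm_fourierT_le _ _
    _ ≤ ∫ y, ‖φ.toFun y‖ ^ 2 := by
        rw [h1, h2]
        exact sq_integral_le_integral_sq ((memLp_stepFn_toFun φ).norm.restrict _)

/-- The mass of `|ζ|^{1-2H}` on `[-1, 1]`. -/
def lowFrequencyConst (H : ℝ) : ℝ :=
  ∫ ζ, Set.indicator (Set.Icc (-1) 1) (fun ζ : ℝ => |ζ| ^ (1 - 2 * H)) ζ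

theorem lintegral_norm_sq_eq {A : Type*} [MeasurableSpace A] {μ : Measure A} {f : A → ℂ}
    (hf : MemLp f 2 μ) :
    ∫⁻ a, ENNReal.ofReal (‖f a‖ ^ 2) ∂μ = ENNReal.ofReal (∫ a, ‖f a‖ ^ 2 ∂μ) :=
  (ofReal_integral_eq_lintegral_ofReal ((memLp_two_iff_integrable_sq_norm hf.1).1 hf)
    (ae_of_all _ fun _ => by positivity)).symm

theorem sobolevNormSq_zero (u : ℝ → ℂ) :
    sobolevNormSq 0 u = ∫⁻ ζ, ENNReal.ofReal (‖fourierT u ζ‖ ^ 2) := by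
  simp [sobolevNormSq]

theorem sobolevNormSq_mono {γ γ' : ℝ} (h : γ ≤ γ') (u : ℝ → ℂ) :
    sobolevNormSq γ u ≤ sobolevNormSq γ' u := by
  refine lintegral_mono fun ζ => ENNReal.ofReal_le_ofReal ?_
  gcongr
  nlinarith

theorem ofReal_integral_stepFn_toFun_sq (φ : StepFn) :
    ENNReal.ofReal (∫ y, ‖φ.toFun y‖ ^ 2)
      = ENNReal.ofReal (2 * spectralConst (1 / 2))⁻¹ * sobolevNormSq 0 φ.toFun := by
  have hK := spectralConst_pos (H := 1 / 2) (by norm_num) (by norm_num)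
  rw [integral_stepFn_toFun_sq, ENNReal.ofReal_mul (by positivity),
    ← lintegral_norm_sq_eq (memLp_stepFn_spectral (by norm_num) (by norm_num) φ),
    sobolevNormSq_zero]
  congr 1
  refine lintegral_congr_ae ?_
  filter_upwards [Measure.ae_ne volume (0 : ℝ)] with ζ hζ
  rw [φ.norm_spectral_sq _ hζ]
  norm_num

/-- The spectral weight splits into the Sobolev weight and its low-frequency part; on the latter
|φ̂|² is replaced by its uniform bound ‖φ‖². -/
theorem lintegral_stepFn_integral_sq_le {Ω : Type*} [MeasurableSpace Ω] {P : Measure Ω} {H : ℝ}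
    {B : ℝ → Ω → ℝ} (hH0 : 0 < H) (hH1 : H < 1) (hB : IsFBM P H B) (φ : StepFn) :
    ∫⁻ o, ENNReal.ofReal (‖φ.integral B o‖ ^ 2) ∂P
      ≤ ENNReal.ofReal (2 * spectralConst H)⁻¹ *
        (sobolevNormSq (max 0 (1 / 2 - H)) φ.toFun
          + ENNReal.ofReal (lowFrequencyConst H) * ENNReal.ofReal (∫ y, ‖φ.toFun y‖ ^ 2)) := by
  have hK := spectralConst_pos hH0 hH1
  have hind : Integrable (Set.indicator (Set.Icc (-1) 1) fun ζ : ℝ => |ζ| ^ (1 - 2 * H)) :=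
    integrable_abs_rpow_indicator (by linarith)
  have hind0 : ∀ ζ, 0 ≤ Set.indicator (Set.Icc (-1) 1) (fun ζ : ℝ => |ζ| ^ (1 - 2 * H)) ζ :=
    fun ζ => Set.indicator_nonneg (fun _ _ => by positivity) _
  rw [lintegral_norm_sq_eq (memLp_stepFn_integral hB φ), integral_stepFn_integral_sq hH0 hH1 hB,
    ENNReal.ofReal_mul (by positivity),
    ← lintegral_norm_sq_eq (memLp_stepFn_spectral hH0 hH1 φ)]
  gcongr
  rw [lowFrequencyConst, ofReal_integral_eq_lintegral_ofReal hind (ae_of_all _ hind0),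
    sobolevNormSq, ← lintegral_mul_const'' _ hind.1.aemeasurable.ennreal_ofReal,
    ← lintegral_add_right' _ (hind.1.aemeasurable.ennreal_ofReal.mul_const _)]
  refine lintegral_mono_ae ?_
  filter_upwards [Measure.ae_ne volume (0 : ℝ)] with ζ hζ
  rw [← ENNReal.ofReal_mul (hind0 ζ), ← ENNReal.ofReal_add (by positivity)
    (mul_nonneg (hind0 ζ) (integral_nonneg fun _ => by positivity)), φ.norm_spectral_sq H hζ]
  refine ENNReal.ofReal_le_ofReal ?_
  calc _ ≤ _ := mul_le_mul_of_nonneg_right (abs_rpow_le_sobolev_weight H ζ) (by positivity)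
    _ ≤ _ := by
      rw [add_mul]
      exact add_le_add le_rfl (mul_le_mul_of_nonneg_left (φ.norm_fourierT_sq_le ζ) (hind0 ζ))

theorem eLpNorm_two_sq {A : Type*} [MeasurableSpace A] (μ : Measure A) (f : A → ℂ) :
    eLpNorm f 2 μ ^ 2 = ∫⁻ a, ENNReal.ofReal (‖f a‖ ^ 2) ∂μ := by
  have h := eLpNorm_nnreal_pow_eq_lintegral (f := f) (μ := μ) (p := 2) (by norm_num)
  simp only [NNReal.coe_ofNat, ENNReal.coe_ofNat, ENNReal.rpow_two] at h
  rw [h]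
  refine lintegral_congr fun a => ?_
  rw [ENNReal.ofReal_pow (norm_nonneg _), ofReal_norm]

/-- The constant in the bound of elementary integrals by the Sobolev norm. -/
def energyConst (H : ℝ) : ℝ≥0∞ :=
  ENNReal.ofReal (2 * spectralConst H)⁻¹ *
    (1 + ENNReal.ofReal (lowFrequencyConst H) * ENNReal.ofReal (2 * spectralConst (1 / 2))⁻¹)

theorem energyConst_ne_top (H : ℝ) : energyConst H ≠ ∞ :=
  ENNReal.mul_ne_top ENNReal.ofReal_ne_top (ENNReal.add_ne_top.2
    ⟨ENNReal.one_ne_top, ENNReal.mul_ne_top ENNReal.ofReal_ne_top ENNReal.ofReal_ne_top⟩)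

/-- The L² term is absorbed by Plancherel, since the Sobolev order is nonnegative. -/
theorem eLpNorm_stepFn_integral_sq_le {Ω : Type*} [MeasurableSpace Ω] {P : Measure Ω} {H : ℝ}
    {B : ℝ → Ω → ℝ} (hH0 : 0 < H) (hH1 : H < 1) (hB : IsFBM P H B) (φ : StepFn) :
    eLpNorm (φ.integral B) 2 P ^ 2
      ≤ energyConst H * sobolevNormSq (max 0 (1 / 2 - H)) φ.toFun := by
  rw [eLpNorm_two_sq, energyConst, mul_assoc, add_mul, one_mul, mul_assoc]
  refine (lintegral_stepFn_integral_sq_le hH0 hH1 hB φ).trans ?_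
  gcongr
  rw [ofReal_integral_stepFn_toFun_sq]
  gcongr
  exact sobolevNormSq_mono (le_max_left _ _) _

/-! ### Differences of step functions and of Sobolev norms -/

/-- The difference of two step functions. -/
def StepFn.sub (φ ψ : StepFn) : StepFn where
  m := φ.m + ψ.m
  a := Fin.append φ.a ψ.a
  b := Fin.append φ.b ψ.b
  c := Fin.append φ.c fun i => -ψ.c i
  zero_le i := by
    refine Fin.addCases (fun i => ?_) (fun i => ?_) i
    · simpa using φ.zero_le i
    · simpa using ψ.zero_le i
  a_le_b i := by
    refine Fin.addCases (fun i => ?_) (fun i => ?_) i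
    · simpa using φ.a_le_b i
    · simpa using ψ.a_le_b i
  le_one i := by
    refine Fin.addCases (fun i => ?_) (fun i => ?_) i
    · simpa using φ.le_one i
    · simpa using ψ.le_one i

theorem StepFn.sub_toFun (φ ψ : StepFn) (y : ℝ) :
    (φ.sub ψ).toFun y = φ.toFun y - ψ.toFun y := by
  unfold StepFn.toFun StepFn.sub
  rw [Fin.sum_univ_add, sub_eq_add_neg, ← Finset.sum_neg_distrib]
  simp only [Fin.append_left, Fin.append_right]
  congr 1
  refine Finset.sum_congr rfl fun i _ => ?_
  simp only [Set.indicator_apply]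
  split_ifs <;> simp

theorem StepFn.sub_integral {Ω : Type*} (φ ψ : StepFn) (B : ℝ → Ω → ℝ) (o : Ω) :
    (φ.sub ψ).integral B o = φ.integral B o - ψ.integral B o := by
  unfold StepFn.integral StepFn.sub
  rw [Fin.sum_univ_add, sub_eq_add_neg, ← Finset.sum_neg_distrib]
  simp only [Fin.append_left, Fin.append_right, neg_mul]

theorem integrable_mul_exp {v : ℝ → ℂ} (hv : Integrable v) (ζ : ℝ) :
    Integrable fun t : ℝ => v t * Complex.exp (-(Complex.I * ζ * t)) :=
  hv.mul_bdd (c := 1) (by fun_prop) (ae_of_all _ fun t => (norm_exp_neg_I_mul ζ t).le)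

theorem fourierT_sub {u v : ℝ → ℂ} (hu : Integrable u) (hv : Integrable v) (ζ : ℝ) :
    fourierT (fun t => u t - v t) ζ = fourierT u ζ - fourierT v ζ := by
  unfold fourierT
  rw [← integral_sub (integrable_mul_exp hu ζ) (integrable_mul_exp hv ζ)]
  simp only [sub_mul]

theorem fourierT_add {u v : ℝ → ℂ} (hu : Integrable u) (hv : Integrable v) (ζ : ℝ) :
    fourierT (fun t => u t + v t) ζ = fourierT u ζ + fourierT v ζ := by
  unfold fourierT
  rw [← integral_add (integrable_mul_exp hu ζ) (integrable_mul_exp hv ζ)]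
  simp only [add_mul]

theorem continuous_fourierT {v : ℝ → ℂ} (hv : Integrable v) : Continuous (fourierT v) := by
  unfold fourierT
  refine continuous_of_dominated (bound := fun t => ‖v t‖)
    (fun ζ => (integrable_mul_exp hv ζ).1) (fun ζ => ae_of_all _ fun t => ?_) hv.norm
    (ae_of_all _ fun t => by fun_prop)
  rw [norm_mul, norm_exp_neg_I_mul, mul_one]

theorem measurable_sobolev_integrand (γ : ℝ) {v : ℝ → ℂ} (hv : Integrable v) :
    Measurable fun ζ : ℝ => ENNReal.ofReal ((1 + ζ ^ 2) ^ γ * ‖fourierT v ζ‖ ^ 2) := by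
  have := (continuous_fourierT hv).measurable
  fun_prop

theorem sobolevNormSq_sub_le (γ : ℝ) {u v : ℝ → ℂ} (hu : Integrable u) (hv : Integrable v) :
    sobolevNormSq γ (fun t => u t - v t) ≤ 2 * (sobolevNormSq γ u + sobolevNormSq γ v) := by
  unfold sobolevNormSq
  rw [← lintegral_add_left (measurable_sobolev_integrand γ hu),
    ← lintegral_const_mul _ (by
      have := measurable_sobolev_integrand γ hu
      have := measurable_sobolev_integrand γ hv
      fun_prop)]
  refine lintegral_mono fun ζ => ?_
  rw [← ENNReal.ofReal_add (by positivity) (by positivity),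
    show (2 : ℝ≥0∞) = ENNReal.ofReal 2 by simp, ← ENNReal.ofReal_mul (by norm_num)]
  refine ENNReal.ofReal_le_ofReal ?_
  rw [fourierT_sub hu hv, ← mul_add, mul_left_comm]
  refine mul_le_mul_of_nonneg_left ?_ (by positivity)
  have := norm_sub_le (fourierT u ζ) (fourierT v ζ)
  nlinarith [sq_nonneg (‖fourierT u ζ‖ - ‖fourierT v ζ‖), norm_nonneg (fourierT u ζ - fourierT v ζ),
    norm_nonneg (fourierT u ζ), norm_nonneg (fourierT v ζ)]

theorem integrable_stepFn_toFun (φ : StepFn) : Integrable φ.toFun := by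
  unfold StepFn.toFun
  refine integrable_finsetSum _ fun i _ => ?_
  rw [integrable_indicator_iff measurableSet_Ioc]
  exact integrableOn_const (by simp)

theorem integrable_zeroExt {g : ℝ → ℂ} (hg : MemLp (zeroExt g) 2) : Integrable (zeroExt g) := by
  have h : IntegrableOn (zeroExt g) (Set.Ioo 0 1) :=
    (hg.restrict (Set.Ioo 0 1)).integrable one_le_two
  have h2 := h.integrable_indicator measurableSet_Ioo
  unfold zeroExt at h2 ⊢
  rwa [Set.indicator_indicator, Set.inter_self] at h2

/-! ### Uniqueness of the stochastic integral, and bounds for it -/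

section Wiener

variable {Ω : Type*} [MeasurableSpace Ω] {P : Measure Ω} {H : ℝ} {B : ℝ → Ω → ℝ}

theorem eLpNorm_stepFn_integral_sub_sq_le (hH0 : 0 < H) (hH1 : H < 1) (hB : IsFBM P H B)
    {g : ℝ → ℂ} (hg : MemLp (zeroExt g) 2) (φ ψ : StepFn) :
    eLpNorm (fun o => φ.integral B o - ψ.integral B o) 2 P ^ 2 ≤ energyConst H *
      (2 * (sobolevNormSq (max 0 (1 / 2 - H)) (fun y => φ.toFun y - zeroExt g y)
        + sobolevNormSq (max 0 (1 / 2 - H)) (fun y => ψ.toFun y - zeroExt g y))) := by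
  have h := eLpNorm_stepFn_integral_sq_le hH0 hH1 hB (φ.sub ψ)
  have h1 : (φ.sub ψ).toFun
      = fun y => (φ.toFun y - zeroExt g y) - (ψ.toFun y - zeroExt g y) := by
    ext y; rw [StepFn.sub_toFun]; ring
  have h2 : (φ.sub ψ).integral B = fun o => φ.integral B o - ψ.integral B o := by
    ext o; rw [StepFn.sub_integral]
  rw [h1, h2] at h
  refine h.trans ?_
  gcongr
  exact sobolevNormSq_sub_le _ ((integrable_stepFn_toFun φ).sub (integrable_zeroExt hg))
    ((integrable_stepFn_toFun ψ).sub (integrable_zeroExt hg))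

theorem tendsto_of_tendsto_sq {ι : Type*} {l : Filter ι} {f : ι → ℝ≥0∞}
    (h : Tendsto (fun i => f i ^ 2) l (𝓝 0)) : Tendsto f l (𝓝 0) := by
  have h2 := h.ennrpow_const (1 / 2)
  rw [ENNReal.zero_rpow_of_pos (by norm_num)] at h2
  refine h2.congr fun i => ?_
  rw [← ENNReal.rpow_natCast, ← ENNReal.rpow_mul]
  norm_num

/-- The filter is arbitrary because the statement serves twice: along ℕ for uniqueness and along ℕ ×
ℕ for the Cauchy property. -/
theorem tendsto_eLpNorm_stepFn_integral_sub (hH0 : 0 < H) (hH1 : H < 1) (hB : IsFBM P H B)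
    {g : ℝ → ℂ} (hg : MemLp (zeroExt g) 2) {ι : Type*} {l : Filter ι} {φ ψ : ι → StepFn}
    (hφ : Tendsto (fun k => sobolevNormSq (max 0 (1 / 2 - H))
      (fun y => (φ k).toFun y - zeroExt g y)) l (𝓝 0))
    (hψ : Tendsto (fun k => sobolevNormSq (max 0 (1 / 2 - H))
      (fun y => (ψ k).toFun y - zeroExt g y)) l (𝓝 0)) :
    Tendsto (fun k => eLpNorm (fun o => (φ k).integral B o - (ψ k).integral B o) 2 P) l (𝓝 0) := by
  refine tendsto_of_tendsto_sq (tendsto_of_tendsto_of_tendsto_of_le_of_le tendsto_const_nhds ?_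
    (fun _ => zero_le) fun k => eLpNorm_stepFn_integral_sub_sq_le hH0 hH1 hB hg (φ k) (ψ k))
  have h := ENNReal.Tendsto.const_mul (a := energyConst H) (ENNReal.Tendsto.const_mul (a := 2)
    (hφ.add hψ) (Or.inr (by simp))) (Or.inr (energyConst_ne_top H))
  simpa using h

theorem IsWienerIntegral.ae_eq (hH0 : 0 < H) (hH1 : H < 1) (hB : IsFBM P H B)
    {g : ℝ → ℂ} {I J : Ω → ℂ} (hI : IsWienerIntegral P H B g I) (hJ : IsWienerIntegral P H B g J) :
    J =ᵐ[P] I := by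
  obtain ⟨hg, hI2, φ, hφ, hφI⟩ := hI
  obtain ⟨-, hJ2, ψ, hψ, hψJ⟩ := hJ
  have h1 := tendsto_eLpNorm_stepFn_integral_sub hH0 hH1 hB hg hφ hψ
  have hle : ∀ k, eLpNorm (J - I) 2 P
      ≤ eLpNorm (fun o => (φ k).integral B o - I o) 2 P
        + eLpNorm (fun o => (φ k).integral B o - (ψ k).integral B o) 2 P
        + eLpNorm (fun o => (ψ k).integral B o - J o) 2 P := by
    intro k
    have hφm := (memLp_stepFn_integral hB (φ k)).1
    have hψm := (memLp_stepFn_integral hB (ψ k)).1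
    have e : J - I = ((fun o => (φ k).integral B o - I o)
        - fun o => (φ k).integral B o - (ψ k).integral B o)
        - fun o => (ψ k).integral B o - J o := by
      ext o; simp
    rw [e]
    refine (eLpNorm_sub_le ((hφm.sub hI2.1).sub (hφm.sub hψm)) (hψm.sub hJ2.1) one_le_two).trans ?_
    exact add_le_add_left (eLpNorm_sub_le (hφm.sub hI2.1) (hφm.sub hψm) one_le_two) _
  have hz : eLpNorm (J - I) 2 P = 0 := by
    have h2 := (hφI.add h1).add hψJ
    simp only [add_zero] at h2
    exact le_antisymm (ge_of_tendsto' h2 hle) zero_le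
  rw [eLpNorm_eq_zero_iff (hJ2.1.sub hI2.1) two_ne_zero] at hz
  filter_upwards [hz] with o ho
  simpa [sub_eq_zero] using ho

theorem eLpNorm_le_of_tendsto_stepFn_integral (hB : IsFBM P H B) {I : Ω → ℂ} (hI : MemLp I 2 P)
    {φ : ℕ → StepFn}
    (h : Tendsto (fun k => eLpNorm (fun o => (φ k).integral B o - I o) 2 P) atTop (𝓝 0))
    {M : ℝ≥0∞} {e : ℕ → ℝ≥0∞} (he : Tendsto e atTop (𝓝 M))
    (hM : ∀ k, eLpNorm ((φ k).integral B) 2 P ^ 2 ≤ e k) : eLpNorm I 2 P ^ 2 ≤ M := by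
  have hle : ∀ k, eLpNorm I 2 P
      ≤ e k ^ (1 / 2 : ℝ) + eLpNorm (fun o => (φ k).integral B o - I o) 2 P := by
    intro k
    have hφm := (memLp_stepFn_integral hB (φ k)).1
    have e1 : I = (φ k).integral B - fun o => (φ k).integral B o - I o := by ext o; simp
    calc eLpNorm I 2 P = eLpNorm ((φ k).integral B - fun o => (φ k).integral B o - I o) 2 P := by
          rw [← e1]
      _ ≤ _ := eLpNorm_sub_le hφm (hφm.sub hI.1) one_le_two
      _ ≤ _ := by
        gcongr
        refine le_trans (le_of_eq ?_) (ENNReal.rpow_le_rpow (hM k) (by norm_num : (0:ℝ) ≤ 1 / 2))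
        rw [← ENNReal.rpow_natCast, ← ENNReal.rpow_mul]
        norm_num
  have hlim := (he.ennrpow_const (1 / 2)).add h
  rw [add_zero] at hlim
  calc eLpNorm I 2 P ^ 2 ≤ (M ^ (1 / 2 : ℝ)) ^ 2 := by
        gcongr; exact ge_of_tendsto' hlim hle
    _ = M := by rw [← ENNReal.rpow_natCast, ← ENNReal.rpow_mul]; norm_num

theorem IsWienerIntegral.eLpNorm_sq_le (hH0 : 0 < H) (hH1 : H < 1) (hB : IsFBM P H B)
    {g : ℝ → ℂ} {I : Ω → ℂ} (hI : IsWienerIntegral P H B g I) :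
    eLpNorm I 2 P ^ 2
      ≤ energyConst H * (2 * sobolevNormSq (max 0 (1 / 2 - H)) (zeroExt g)) := by
  obtain ⟨hg, hI2, φ, hφ, hφI⟩ := hI
  refine eLpNorm_le_of_tendsto_stepFn_integral hB hI2 hφI
    (e := fun k => energyConst H * (2 * (sobolevNormSq (max 0 (1 / 2 - H))
      (fun y => (φ k).toFun y - zeroExt g y)
        + sobolevNormSq (max 0 (1 / 2 - H)) (fun y => - zeroExt g y)))) ?_ fun k => ?_
  · have hn : sobolevNormSq (max 0 (1 / 2 - H)) (fun y => - zeroExt g y)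
        = sobolevNormSq (max 0 (1 / 2 - H)) (zeroExt g) := by
      unfold sobolevNormSq fourierT
      simp only [neg_mul, integral_neg, norm_neg]
    have h := ENNReal.Tendsto.const_mul (a := energyConst H) (ENNReal.Tendsto.const_mul (a := 2)
      (hφ.add_const (sobolevNormSq (max 0 (1 / 2 - H)) (fun y => - zeroExt g y)))
      (Or.inr (by simp))) (Or.inr (energyConst_ne_top H))
    rw [zero_add] at h
    simpa only [hn] using h
  · refine (eLpNorm_stepFn_integral_sq_le hH0 hH1 hB (φ k)).trans ?_
    gcongr
    -- Uses φ_k = (φ_k - g) - (-g), with g extended by zero; the first term vanishes in the limit.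
    have := sobolevNormSq_sub_le (max 0 (1 / 2 - H)) (u := fun y => (φ k).toFun y - zeroExt g y)
      (v := fun y => -zeroExt g y)
      ((integrable_stepFn_toFun (φ k)).sub (integrable_zeroExt hg)) (integrable_zeroExt hg).neg
    simpa only [sub_neg_eq_add, sub_add_cancel] using this

/-- The elementary integrals are Cauchy in L²(P), which is complete. The conclusion keeps the given
sequence so that bounds along it pass to the integral. -/
theorem exists_isWienerIntegral (hH0 : 0 < H) (hH1 : H < 1) (hB : IsFBM P H B)
    {g : ℝ → ℂ} (hg : MemLp (zeroExt g) 2) {φ : ℕ → StepFn}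
    (hφ : Tendsto (fun k => sobolevNormSq (max 0 (1 / 2 - H))
      (fun y => (φ k).toFun y - zeroExt g y)) atTop (𝓝 0)) :
    ∃ I, IsWienerIntegral P H B g I ∧
      Tendsto (fun k => eLpNorm (fun o => (φ k).integral B o - I o) 2 P) atTop (𝓝 0) := by
  have : Fact ((1 : ℝ≥0∞) ≤ 2) := ⟨one_le_two⟩
  have hm := fun k => memLp_stepFn_integral hB (φ k)
  have hc : CauchySeq fun k => (hm k).toLp := by
    rw [Lp.cauchySeq_Lp_iff_cauchySeq_eLpNorm]
    have h := tendsto_eLpNorm_stepFn_integral_sub hH0 hH1 hB hg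
      (φ := fun n : ℕ × ℕ => φ n.1) (ψ := fun n : ℕ × ℕ => φ n.2) (l := atTop)
      (hφ.comp (by rw [← prod_atTop_atTop_eq]; exact tendsto_fst))
      (hφ.comp (by rw [← prod_atTop_atTop_eq]; exact tendsto_snd))
    refine h.congr fun n => eLpNorm_congr_ae ?_
    filter_upwards [(hm n.1).coeFn_toLp, (hm n.2).coeFn_toLp] with o h1 h2
    simp [h1, h2]
  obtain ⟨F, hF⟩ := cauchySeq_tendsto_of_complete hc
  rw [Lp.tendsto_Lp_iff_tendsto_eLpNorm'] at hF
  have hF' : Tendsto (fun k => eLpNorm (fun o => (φ k).integral B o - F o) 2 P) atTop (𝓝 0) := by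
    refine hF.congr fun k => eLpNorm_congr_ae ?_
    filter_upwards [(hm k).coeFn_toLp] with o h1
    simp [h1]
  exact ⟨F, ⟨hg, Lp.memLp F, φ, hφ, hF'⟩, hF'⟩

end Wiener

/-! ### Approximation of smooth functions by step functions -/

/-- One integration by parts against the unimodular exponential. -/
theorem abs_mul_norm_integral_mul_exp_le {V V' : ℝ → ℂ} (hV : ∀ y, HasDerivAt V (V' y) y)
    (hV' : Continuous V') {a b : ℝ} (hab : a ≤ b) (ζ : ℝ) :
    |ζ| * ‖∫ t in a..b, V t * Complex.exp (-(Complex.I * ζ * t))‖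
      ≤ ‖V a‖ + ‖V b‖ + ∫ t in a..b, ‖V' t‖ := by
  have he : ∀ t : ℝ, HasDerivAt (fun t : ℝ => Complex.exp (-(Complex.I * ζ * t)))
      (-(Complex.I * ζ) * Complex.exp (-(Complex.I * ζ * t))) t := by
    intro t
    have h1 : HasDerivAt (fun t : ℝ => -(Complex.I * ζ) * (t : ℂ)) (-(Complex.I * ζ) * 1) t :=
      (Complex.ofRealCLM.hasDerivAt (x := t)).const_mul _
    have h2 := h1.cexp
    simp only [mul_one, neg_mul] at h2 ⊢
    convert! h2 using 1
    ring
  have hparts := intervalIntegral.integral_mul_deriv_eq_deriv_mul (a := a) (b := b)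
    (fun t _ => hV t) (fun t _ => he t) (hV'.intervalIntegrable _ _)
    (Continuous.intervalIntegrable (by fun_prop) _ _)
  have hl : ∫ t in a..b, V t * (-(Complex.I * ζ) * Complex.exp (-(Complex.I * ζ * t)))
      = -(Complex.I * ζ) * ∫ t in a..b, V t * Complex.exp (-(Complex.I * ζ * t)) := by
    rw [← intervalIntegral.integral_const_mul]
    congr 1; ext t; ring
  rw [hl] at hparts
  have hn := congrArg norm hparts
  rw [norm_mul, norm_neg, norm_mul, Complex.norm_I, one_mul, Complex.norm_real,
    Real.norm_eq_abs] at hn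
  rw [hn]
  refine (norm_sub_le _ _).trans (add_le_add ((norm_sub_le _ _).trans ?_) ?_)
  · rw [norm_mul, norm_mul, norm_exp_neg_I_mul, norm_exp_neg_I_mul, mul_one, mul_one, add_comm]
  · refine (intervalIntegral.norm_integral_le_integral_norm hab).trans_eq ?_
    simp only [norm_mul, norm_exp_neg_I_mul, mul_one]

theorem fourierT_indicator_eq {a b : ℝ} (hab : a ≤ b) (f : ℝ → ℂ) (ζ : ℝ) :
    fourierT (Set.indicator (Set.Ioc a b) f) ζ
      = ∫ t in a..b, f t * Complex.exp (-(Complex.I * ζ * t)) := by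
  unfold fourierT
  rw [intervalIntegral.integral_of_le hab, ← integral_indicator measurableSet_Ioc]
  congr 1; ext t
  simp only [Set.indicator_apply]
  split_ifs <;> simp

theorem fourierT_zeroExt (g : ℝ → ℂ) (ζ : ℝ) :
    fourierT (zeroExt g) ζ = ∫ t in (0 : ℝ)..1, g t * Complex.exp (-(Complex.I * ζ * t)) := by
  rw [intervalIntegral.integral_of_le zero_le_one, integral_Ioc_eq_integral_Ioo,
    ← integral_indicator measurableSet_Ioo]
  unfold fourierT zeroExt
  congr 1; ext t
  simp only [Set.indicator_apply]
  split_ifs <;> simp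

theorem sq_le_of_le_of_abs_mul_le {x ζ A : ℝ} (hx : 0 ≤ x) (h1 : x ≤ A) (h2 : |ζ| * x ≤ A) :
    x ^ 2 ≤ 2 * A ^ 2 * (1 + ζ ^ 2)⁻¹ := by
  have h0 : (0 : ℝ) < 1 + ζ ^ 2 := by positivity
  rw [← div_eq_mul_inv, le_div_iff₀ h0]
  have h3 : x ^ 2 ≤ A ^ 2 := by gcongr
  have h4 : (|ζ| * x) ^ 2 ≤ A ^ 2 := by gcongr
  rw [mul_pow, sq_abs] at h4
  linarith

/-- The mass of `(1 + ζ²)^{γ-1}` with `γ = max 0 (1/2 - H)`. -/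
def sobolevTailConst (H : ℝ) : ℝ :=
  ∫ ζ : ℝ, (1 + ζ ^ 2) ^ max 0 (1 / 2 - H) * (1 + ζ ^ 2)⁻¹

theorem sobolevTailConst_nonneg (H : ℝ) : 0 ≤ sobolevTailConst H :=
  integral_nonneg fun _ => by positivity

theorem sobolevNormSq_le_of_fourierT_le {H : ℝ} (hH0 : 0 < H) {u : ℝ → ℂ} {A : ℝ}
    (h1 : ∀ ζ, ‖fourierT u ζ‖ ≤ A) (h2 : ∀ ζ, |ζ| * ‖fourierT u ζ‖ ≤ A) :
    sobolevNormSq (max 0 (1 / 2 - H)) u ≤ ENNReal.ofReal (2 * A ^ 2 * sobolevTailConst H) := by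
  rw [sobolevTailConst, ← integral_const_mul, ofReal_integral_eq_lintegral_ofReal
    ((integrable_one_add_sq_rpow (sobolev_order_lt hH0)).const_mul _)
    (ae_of_all _ fun ζ => by positivity)]
  refine lintegral_mono fun ζ => ENNReal.ofReal_le_ofReal ?_
  have h := sq_le_of_le_of_abs_mul_le (norm_nonneg _) (h1 ζ) (h2 ζ)
  rw [mul_left_comm]
  exact mul_le_mul_of_nonneg_left h (by positivity)

/-- Dominated convergence with a multiple of (1 + ζ²)^{γ-1} as majorant. -/
theorem tendsto_sobolevNormSq_of_fourierT {H : ℝ} (hH0 : 0 < H) {u : ℕ → ℝ → ℂ}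
    (hu : ∀ k, Integrable (u k)) {A : ℝ} (h1 : ∀ k ζ, ‖fourierT (u k) ζ‖ ≤ A)
    (h2 : ∀ k ζ, |ζ| * ‖fourierT (u k) ζ‖ ≤ A)
    (h3 : ∀ ζ, Tendsto (fun k => fourierT (u k) ζ) atTop (𝓝 0)) :
    Tendsto (fun k => sobolevNormSq (max 0 (1 / 2 - H)) (u k)) atTop (𝓝 0) := by
  have hlim := tendsto_lintegral_of_dominated_convergence (μ := volume)
    (F := fun k ζ => ENNReal.ofReal ((1 + ζ ^ 2) ^ max 0 (1 / 2 - H) * ‖fourierT (u k) ζ‖ ^ 2))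
    (f := fun _ => 0)
    (fun ζ : ℝ => ENNReal.ofReal (2 * A ^ 2 * ((1 + ζ ^ 2) ^ max 0 (1 / 2 - H) * (1 + ζ ^ 2)⁻¹)))
    (fun k => measurable_sobolev_integrand _ (hu k))
    (fun k => ae_of_all _ fun ζ => ENNReal.ofReal_le_ofReal (by
      rw [mul_left_comm]
      exact mul_le_mul_of_nonneg_left
        (sq_le_of_le_of_abs_mul_le (norm_nonneg _) (h1 k ζ) (h2 k ζ)) (by positivity)))
    (by
      rw [← ofReal_integral_eq_lintegral_ofReal
        ((integrable_one_add_sq_rpow (sobolev_order_lt hH0)).const_mul _)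
        (ae_of_all _ fun ζ => by positivity)]
      exact ENNReal.ofReal_ne_top)
    (ae_of_all _ fun ζ => by
      have h := ((((h3 ζ).norm).pow 2).const_mul ((1 + ζ ^ 2) ^ max 0 (1 / 2 - H)))
      have h' := ENNReal.tendsto_ofReal h
      simpa using h')
  simpa [sobolevNormSq] using hlim

/-- The step function on the uniform partition of `(0,1]` into `N + 1` intervals that takes the
values of `g` at the left endpoints. -/
def leftEndpointStep (g : ℝ → ℂ) (N : ℕ) : StepFn where
  m := N + 1
  a i := i / (N + 1)
  b i := (i + 1) / (N + 1)
  c i := g (i / (N + 1))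
  zero_le i := by positivity
  a_le_b i := by gcongr; linarith
  le_one i := by
    rw [div_le_one (by positivity)]
    have : (i : ℕ) + 1 ≤ N + 1 := i.2
    exact_mod_cast this

theorem leftEndpointStep_toFun (g : ℝ → ℂ) (N : ℕ) (y : ℝ) :
    (leftEndpointStep g N).toFun y = ∑ i ∈ Finset.range (N + 1),
      Set.indicator (Set.Ioc ((i : ℝ) / (N + 1)) ((i + 1) / (N + 1)))
        (fun _ => g (i / (N + 1))) y :=
  Fin.sum_univ_eq_sum_range (fun i : ℕ => Set.indicator
    (Set.Ioc ((i : ℝ) / (N + 1)) ((i + 1) / (N + 1))) (fun _ => g (i / (N + 1))) y) (N + 1)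

theorem norm_leftEndpointStep_le {g : ℝ → ℂ} {S : ℝ} (hS : ∀ y ∈ Set.Icc (0 : ℝ) 1, ‖g y‖ ≤ S)
    (N : ℕ) (y : ℝ) :
    ‖(leftEndpointStep g N).toFun y‖ ≤ Set.indicator (Set.Ioc 0 1) (fun _ => S) y := by
  rw [leftEndpointStep_toFun]
  -- Each cell is a difference of indicators of (0, x], so the sum telescopes to the indicator of
  -- (0,1].
  have hstep : ∀ i ∈ Finset.range (N + 1), ‖Set.indicator
      (Set.Ioc ((i : ℝ) / (N + 1)) ((i + 1) / (N + 1))) (fun _ => g (i / (N + 1))) y‖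
      ≤ Set.indicator (Set.Ioc 0 (((i + 1 : ℕ) : ℝ) / (N + 1))) (fun _ => S) y
        - Set.indicator (Set.Ioc 0 ((i : ℝ) / (N + 1))) (fun _ => S) y := by
    intro i hi
    have hi' : (i : ℝ) + 1 ≤ N + 1 := by exact_mod_cast Finset.mem_range.1 hi
    have h0 : 0 ≤ (i : ℝ) / (N + 1) := by positivity
    have h1 : (i : ℝ) / (N + 1) ≤ 1 := by rw [div_le_one (by positivity)]; linarith
    have h2 : (i : ℝ) / (N + 1) ≤ (i + 1) / (N + 1) := by gcongr; linarith
    have hS' := hS _ ⟨h0, h1⟩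
    push_cast
    simp only [Set.indicator_apply, Set.mem_Ioc]
    split_ifs <;> first | (simp; done) | (simp; linarith) | grind
  refine (norm_sum_le _ _).trans ((Finset.sum_le_sum hstep).trans_eq ?_)
  rw [Finset.sum_range_sub
    (fun i : ℕ => Set.indicator (Set.Ioc 0 ((i : ℝ) / (N + 1))) (fun _ => S) y)]
  have : ((N : ℝ) + 1) / (N + 1) = 1 := div_self (by positivity)
  simp [this]

theorem integral_leftEndpointStep_sq_le {g : ℝ → ℂ} {S : ℝ}
    (hS : ∀ y ∈ Set.Icc (0 : ℝ) 1, ‖g y‖ ≤ S) (N : ℕ) :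
    ∫ y, ‖(leftEndpointStep g N).toFun y‖ ^ 2 ≤ S ^ 2 := by
  have h : ∀ y, ‖(leftEndpointStep g N).toFun y‖ ^ 2
      ≤ Set.indicator (Set.Ioc (0 : ℝ) 1) (fun _ => S ^ 2) y := by
    intro y
    have := norm_leftEndpointStep_le hS N y
    by_cases hy : y ∈ Set.Ioc (0 : ℝ) 1
    · simp only [Set.indicator_of_mem hy] at this ⊢
      gcongr
    · rw [StepFn.toFun_eq_zero _ hy, Set.indicator_of_notMem hy]
      simp
  refine (integral_mono_of_nonneg (ae_of_all _ fun _ => by positivity) ?_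
    (ae_of_all _ h)).trans_eq ?_
  · rw [integrable_indicator_iff measurableSet_Ioc]
    exact integrableOn_const (by simp)
  · simp [integral_indicator_const]

theorem memLp_zeroExt {g : ℝ → ℂ} (hg : Continuous g) : MemLp (zeroExt g) 2 := by
  obtain ⟨S, hS⟩ := isCompact_Icc.exists_bound_of_continuousOn (s := Set.Icc (0 : ℝ) 1)
    hg.continuousOn
  unfold zeroExt
  rw [memLp_indicator_iff_restrict measurableSet_Ioo]
  refine MemLp.of_bound hg.aestronglyMeasurable S ?_
  filter_upwards [ae_restrict_mem measurableSet_Ioo] with y hy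
  exact hS y (Set.Ioo_subset_Icc_self hy)

theorem fourierT_leftEndpointStep_sub {g : ℝ → ℂ} (hg : Continuous g) (N : ℕ) (ζ : ℝ) :
    fourierT (fun y => (leftEndpointStep g N).toFun y - zeroExt g y) ζ
      = ∑ i ∈ Finset.range (N + 1), ∫ t in ((i : ℝ) / (N + 1))..((i + 1 : ℕ) : ℝ) / (N + 1),
          (g (i / (N + 1)) - g t) * Complex.exp (-(Complex.I * ζ * t)) := by
  rw [fourierT_sub (integrable_stepFn_toFun _) (integrable_zeroExt (memLp_zeroExt hg)),
    StepFn.fourierT_toFun, fourierT_zeroExt]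
  have h1 : ∑ i ∈ Finset.range (N + 1), ∫ t in ((i : ℝ) / (N + 1))..((i + 1 : ℕ) : ℝ) / (N + 1),
      g t * Complex.exp (-(Complex.I * ζ * t))
      = ∫ t in (0 : ℝ)..1, g t * Complex.exp (-(Complex.I * ζ * t)) := by
    rw [intervalIntegral.sum_integral_adjacent_intervals (a := fun i : ℕ => (i : ℝ) / (N + 1))
      fun k _ => Continuous.intervalIntegrable (by fun_prop) _ _]
    have : ((N : ℝ) + 1) / (N + 1) = 1 := div_self (by positivity)
    simp [this]
  have h2 : ∑ i, fourierT (Set.indicator (Set.Ioc ((leftEndpointStep g N).a i)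
      ((leftEndpointStep g N).b i)) fun _ => (leftEndpointStep g N).c i) ζ
      = ∑ i ∈ Finset.range (N + 1), ∫ t in ((i : ℝ) / (N + 1))..((i + 1 : ℕ) : ℝ) / (N + 1),
        g (i / (N + 1)) * Complex.exp (-(Complex.I * ζ * t)) := by
    rw [← Fin.sum_univ_eq_sum_range (fun i : ℕ =>
      ∫ t in ((i : ℝ) / (N + 1))..((i + 1 : ℕ) : ℝ) / (N + 1),
        g (i / (N + 1)) * Complex.exp (-(Complex.I * ζ * t))) (N + 1)]
    refine Finset.sum_congr rfl fun i _ => ?_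
    rw [fourierT_indicator_eq (StepFn.a_le_b _ i)]
    simp [leftEndpointStep]
  rw [h2, ← h1, ← Finset.sum_sub_distrib]
  refine Finset.sum_congr rfl fun i _ => ?_
  rw [← intervalIntegral.integral_sub (Continuous.intervalIntegrable (by fun_prop) _ _)
    (Continuous.intervalIntegrable (by fun_prop) _ _)]
  simp only [sub_mul]

/-- With L bounding |g'| on [0,1], the error is at most L/(N+1), so its transform tends to 0.
Integration by parts on each of the N + 1 cells costs at most 2L/(N+1), which keeps |ζ| times the
transform below 2L. -/
theorem tendsto_sobolevNormSq_leftEndpointStep {H : ℝ} (hH0 : 0 < H) {g g' : ℝ → ℂ}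
    (hg : ∀ y, HasDerivAt g (g' y) y) (hg' : Continuous g') :
    Tendsto (fun N => sobolevNormSq (max 0 (1 / 2 - H))
      (fun y => (leftEndpointStep g N).toFun y - zeroExt g y)) atTop (𝓝 0) := by
  have hgc : Continuous g := continuous_iff_continuousAt.2 fun y => (hg y).continuousAt
  obtain ⟨L, hL⟩ := isCompact_Icc.exists_bound_of_continuousOn (s := Set.Icc (0 : ℝ) 1)
    hg'.continuousOn
  have hL0 : 0 ≤ L := (norm_nonneg _).trans (hL 0 (by simp))
  have hloc : ∀ (N i : ℕ), i < N + 1 → ∀ t ∈ Set.Icc ((i : ℝ) / (N + 1))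
      (((i + 1 : ℕ) : ℝ) / (N + 1)), t ∈ Set.Icc (0 : ℝ) 1 ∧
        ‖g (i / (N + 1)) - g t‖ ≤ L / (N + 1) := by
    intro N i hi t ht
    have hi' : ((i + 1 : ℕ) : ℝ) ≤ N + 1 := by exact_mod_cast hi
    have h0 : 0 ≤ (i : ℝ) / (N + 1) := by positivity
    have h1 : ((i + 1 : ℕ) : ℝ) / (N + 1) ≤ 1 := by rwa [div_le_one (by positivity)]
    have ht1 : t ∈ Set.Icc (0 : ℝ) 1 := ⟨h0.trans ht.1, ht.2.trans h1⟩
    refine ⟨ht1, ?_⟩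
    have h := (convex_Icc (0 : ℝ) 1).norm_image_sub_le_of_norm_hasDerivWithin_le
      (fun x _ => (hg x).hasDerivWithinAt) hL ht1 ⟨h0, (ht.1.trans ht.2).trans h1⟩
    refine h.trans ?_
    rw [div_eq_mul_one_div L]
    gcongr
    rw [Real.norm_eq_abs, abs_le]
    have : ((i + 1 : ℕ) : ℝ) / (N + 1) = i / (N + 1) + 1 / (N + 1) := by push_cast; ring
    constructor <;> linarith [ht.1, ht.2, (by positivity : (0 : ℝ) ≤ 1 / (N + 1))]
  have hlen : ∀ N i : ℕ, ((i + 1 : ℕ) : ℝ) / (N + 1) - i / (N + 1) = 1 / ((N : ℝ) + 1) := by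
    intro N i; push_cast; ring
  have hle : ∀ N i : ℕ, (i : ℝ) / (N + 1) ≤ ((i + 1 : ℕ) : ℝ) / (N + 1) := by
    intro N i; gcongr; simp
  have hsup : ∀ (N : ℕ) (ζ : ℝ),
      ‖fourierT (fun y => (leftEndpointStep g N).toFun y - zeroExt g y) ζ‖ ≤ L / (N + 1) := by
    intro N ζ
    rw [fourierT_leftEndpointStep_sub hgc]
    calc _ ≤ ∑ i ∈ Finset.range (N + 1), L / (N + 1) * (1 / ((N : ℝ) + 1)) := by
          refine norm_sum_le_of_le _ fun i hi => ?_
          have hb := intervalIntegral.norm_integral_le_of_norm_le_const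
            (f := fun t => (g (i / (N + 1)) - g t) * Complex.exp (-(Complex.I * ζ * t)))
            (a := (i : ℝ) / (N + 1)) (b := ((i + 1 : ℕ) : ℝ) / (N + 1)) (C := L / (N + 1))
            fun t ht => by
              rw [Set.uIoc_of_le (hle N i)] at ht
              rw [norm_mul, norm_exp_neg_I_mul, mul_one]
              exact (hloc N i (Finset.mem_range.1 hi) t (Set.Ioc_subset_Icc_self ht)).2
          rwa [hlen, abs_of_nonneg (by positivity)] at hb
      _ = L / (N + 1) := by
          rw [Finset.sum_const, Finset.card_range, nsmul_eq_mul]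
          push_cast
          field_simp
  have hder : ∀ (N : ℕ) (ζ : ℝ),
      |ζ| * ‖fourierT (fun y => (leftEndpointStep g N).toFun y - zeroExt g y) ζ‖ ≤ 2 * L := by
    intro N ζ
    rw [fourierT_leftEndpointStep_sub hgc]
    calc _ ≤ |ζ| * ∑ i ∈ Finset.range (N + 1), _ :=
          mul_le_mul_of_nonneg_left (norm_sum_le _ _) (abs_nonneg _)
      _ = ∑ i ∈ Finset.range (N + 1), |ζ| * _ := Finset.mul_sum _ _ _
      _ ≤ ∑ i ∈ Finset.range (N + 1), 2 * L / (N + 1) := by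
          refine Finset.sum_le_sum fun i hi => ?_
          have hi' := Finset.mem_range.1 hi
          have hp := abs_mul_norm_integral_mul_exp_le (V := fun t => g (i / (N + 1)) - g t)
            (V' := fun t => -g' t) (fun y => by simpa using (hg y).const_sub (g (i / (N + 1))))
            hg'.neg (hle N i) ζ
          refine hp.trans ?_
          have h1 := (hloc N i hi' _ (Set.right_mem_Icc.2 (hle N i))).2
          have h2 := intervalIntegral.norm_integral_le_of_norm_le_const
            (f := fun t => ‖-g' t‖)
            (a := (i : ℝ) / (N + 1)) (b := ((i + 1 : ℕ) : ℝ) / (N + 1)) (C := L)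
            fun t ht => by
              rw [Set.uIoc_of_le (hle N i)] at ht
              rw [norm_norm, norm_neg]
              exact hL t (hloc N i hi' t (Set.Ioc_subset_Icc_self ht)).1
          rw [hlen, abs_of_nonneg (by positivity)] at h2
          have h3 := (Real.le_norm_self _).trans h2
          -- The boundary term at the left endpoint vanishes because the step takes the value of g
          -- there.
          rw [sub_self, norm_zero, zero_add]
          calc _ ≤ L / (N + 1) + L * (1 / (N + 1)) := add_le_add h1 h3
            _ = _ := by ring
      _ = 2 * L := by
          rw [Finset.sum_const, Finset.card_range, nsmul_eq_mul]
          push_cast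
          field_simp
  refine tendsto_sobolevNormSq_of_fourierT hH0 (A := 2 * L)
    (fun N => (integrable_stepFn_toFun _).sub (integrable_zeroExt (memLp_zeroExt hgc)))
    (fun N ζ => (hsup N ζ).trans ?_) hder fun ζ => squeeze_zero_norm (fun N => hsup N ζ) ?_
  · rw [div_le_iff₀ (by positivity)]
    nlinarith [(Nat.cast_nonneg N : (0 : ℝ) ≤ N)]
  · simpa [div_eq_mul_inv] using (tendsto_one_div_add_atTop_nhds_zero_nat (𝕜 := ℝ)).const_mul L

theorem sobolevNormSq_zeroExt_le {H : ℝ} (hH0 : 0 < H) {g g' : ℝ → ℂ}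
    (hg : ∀ y, HasDerivAt g (g' y) y) (hg' : Continuous g') {A : ℝ}
    (h1 : ∀ y ∈ Set.Icc (0 : ℝ) 1, ‖g y‖ ≤ A)
    (h2 : ‖g 0‖ + ‖g 1‖ + ∫ t in (0 : ℝ)..1, ‖g' t‖ ≤ A) :
    sobolevNormSq (max 0 (1 / 2 - H)) (zeroExt g)
      ≤ ENNReal.ofReal (2 * A ^ 2 * sobolevTailConst H) := by
  refine sobolevNormSq_le_of_fourierT_le hH0 (fun ζ => ?_) fun ζ => ?_
  · rw [fourierT_zeroExt]
    have hb := intervalIntegral.norm_integral_le_of_norm_le_const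
      (f := fun t => g t * Complex.exp (-(Complex.I * ζ * t))) (a := 0) (b := 1) (C := A)
      fun t ht => by
        rw [Set.uIoc_of_le zero_le_one] at ht
        rw [norm_mul, norm_exp_neg_I_mul, mul_one]
        exact h1 t (Set.Ioc_subset_Icc_self ht)
    simpa using hb
  · rw [fourierT_zeroExt]
    exact (abs_mul_norm_integral_mul_exp_le hg hg' zero_le_one ζ).trans h2

/-! ### The stochastic integral of a smooth function -/

section Wiener

variable {Ω : Type*} [MeasurableSpace Ω] {P : Measure Ω} {H : ℝ} {B : ℝ → Ω → ℝ}

theorem IsWienerIntegral.congr {g h : ℝ → ℂ} (hgh : zeroExt g = zeroExt h) {I : Ω → ℂ}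
    (hI : IsWienerIntegral P H B g I) : IsWienerIntegral P H B h I := by
  unfold IsWienerIntegral at hI ⊢
  rwa [← hgh]

theorem exists_isWienerIntegral_of_hasDerivAt (hH0 : 0 < H) (hH1 : H < 1) (hB : IsFBM P H B)
    {g g' : ℝ → ℂ} (hg : ∀ y, HasDerivAt g (g' y) y) (hg' : Continuous g') :
    ∃ I, IsWienerIntegral P H B g I ∧
      Tendsto (fun k => eLpNorm (fun o => (leftEndpointStep g k).integral B o - I o) 2 P)
        atTop (𝓝 0) :=
  exists_isWienerIntegral hH0 hH1 hB
    (memLp_zeroExt (continuous_iff_continuousAt.2 fun y => (hg y).continuousAt))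
    (tendsto_sobolevNormSq_leftEndpointStep hH0 hg hg')

/-- The constant in the bound of the stochastic integral by the supremum norm for `H ≥ 1/2`. -/
def supBoundConst (H : ℝ) : ℝ :=
  (2 * spectralConst H)⁻¹ * (2 * spectralConst (1 / 2) + lowFrequencyConst H)

theorem lowFrequencyConst_nonneg (H : ℝ) : 0 ≤ lowFrequencyConst H :=
  integral_nonneg fun _ => Set.indicator_nonneg (fun _ _ => by positivity) _

theorem supBoundConst_nonneg (hH0 : 0 < H) (hH1 : H < 1) : 0 ≤ supBoundConst H := by
  have h1 := spectralConst_pos hH0 hH1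
  have h2 := spectralConst_pos (H := 1 / 2) (by norm_num) (by norm_num)
  have h3 := lowFrequencyConst_nonneg H
  unfold supBoundConst
  positivity

/-- For H ≥ 1/2 the Sobolev order is 0 and the left-endpoint sums have L² norm at most S. The
derivative is used only for convergence and leaves no trace in the bound. -/
theorem IsWienerIntegral.eLpNorm_sq_le_of_norm_le (hH : 1 / 2 ≤ H) (hH1 : H < 1)
    (hB : IsFBM P H B) {g g' : ℝ → ℂ} (hg : ∀ y, HasDerivAt g (g' y) y) (hg' : Continuous g')
    {S : ℝ} (hS : ∀ y ∈ Set.Icc (0 : ℝ) 1, ‖g y‖ ≤ S) {I : Ω → ℂ}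
    (hI : IsWienerIntegral P H B g I) :
    eLpNorm I 2 P ^ 2 ≤ ENNReal.ofReal (supBoundConst H * S ^ 2) := by
  have hH0 : 0 < H := by linarith
  have hK := spectralConst_pos hH0 hH1
  have hK2 := spectralConst_pos (H := 1 / 2) (by norm_num) (by norm_num)
  have hlow := lowFrequencyConst_nonneg H
  obtain ⟨J, hJ, hlim⟩ := exists_isWienerIntegral_of_hasDerivAt hH0 hH1 hB hg hg'
  rw [eLpNorm_congr_ae (hJ.ae_eq hH0 hH1 hB hI)]
  refine eLpNorm_le_of_tendsto_stepFn_integral hB hJ.2.1 hlim tendsto_const_nhds fun N => ?_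
  rw [eLpNorm_two_sq]
  refine (lintegral_stepFn_integral_sq_le hH0 hH1 hB _).trans ?_
  have hγ : max 0 (1 / 2 - H) = 0 := max_eq_left (by linarith)
  have hsob : sobolevNormSq 0 (leftEndpointStep g N).toFun = ENNReal.ofReal
      (2 * spectralConst (1 / 2) * ∫ y, ‖(leftEndpointStep g N).toFun y‖ ^ 2) := by
    rw [ENNReal.ofReal_mul (by positivity), ofReal_integral_stepFn_toFun_sq, ← mul_assoc,
      ← ENNReal.ofReal_mul (by positivity), mul_inv_cancel₀ (by positivity), ENNReal.ofReal_one,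
      one_mul]
  have hnn : 0 ≤ ∫ y, ‖(leftEndpointStep g N).toFun y‖ ^ 2 :=
    integral_nonneg fun _ => by positivity
  rw [hγ, hsob, ← ENNReal.ofReal_mul hlow, ← ENNReal.ofReal_add (by positivity) (by positivity),
    ← ENNReal.ofReal_mul (by positivity)]
  refine ENNReal.ofReal_le_ofReal ?_
  rw [← add_mul, ← mul_assoc]
  exact mul_le_mul_of_nonneg_left (integral_leftEndpointStep_sq_le hS N)
    (supBoundConst_nonneg hH0 hH1)

theorem integral_norm_sq_le_of_eLpNorm {I : Ω → ℂ} (hI : MemLp I 2 P) {M : ℝ} (hM : 0 ≤ M)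
    (h : eLpNorm I 2 P ^ 2 ≤ ENNReal.ofReal M) : ∫ o, ‖I o‖ ^ 2 ∂P ≤ M := by
  rwa [eLpNorm_two_sq, lintegral_norm_sq_eq hI, ENNReal.ofReal_le_ofReal_iff hM] at h

end Wiener

/-! ### The symbol -/

theorem I_mul_cpow {ω : ℝ} (hω : ω ≠ 0) (a : ℝ) :
    (Complex.I * ω) ^ (a : ℂ) = ((|ω| ^ a * Real.cos (a * (Real.pi / 2)) : ℝ) : ℂ)
      + ((SignType.sign ω : ℝ) * (|ω| ^ a * Real.sin (a * (Real.pi / 2))) : ℝ) * Complex.I := by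
  rw [Complex.cpow_ofReal, norm_mul, Complex.norm_I, one_mul, Complex.norm_real,
    Real.norm_eq_abs]
  rcases lt_or_gt_of_ne hω with h | h
  · have harg : (Complex.I * ω).arg = -(Real.pi / 2) := by
      have : Complex.I * ω = ((-ω : ℝ) : ℂ) * (-Complex.I) := by push_cast; ring
      rw [this, Complex.arg_real_mul _ (by linarith), Complex.arg_neg_I]
    rw [harg, sign_neg h, neg_mul, Real.cos_neg, Real.sin_neg, mul_comm a, SignType.coe_neg_one]
    push_cast
    ring
  · have harg : (Complex.I * ω).arg = Real.pi / 2 := by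
      rw [mul_comm, Complex.arg_real_mul _ h, Complex.arg_I]
    rw [harg, sign_pos h, mul_comm a, SignType.coe_one]
    push_cast
    ring

theorem sin_mul_pi_div_two_nonneg {a : ℝ} (h0 : 0 < a) (h2 : a ≤ 2) :
    0 ≤ Real.sin (a * (Real.pi / 2)) :=
  Real.sin_nonneg_of_nonneg_of_le_pi (by positivity) (by nlinarith [Real.pi_pos])

theorem sin_mul_pi_div_two_pos {a : ℝ} (h0 : 0 < a) (h2 : a < 2) :
    0 < Real.sin (a * (Real.pi / 2)) :=
  Real.sin_pos_of_pos_of_lt_pi (by positivity) (by nlinarith [Real.pi_pos])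

/-- Since 0 < α k ≤ 2, every sine is nonnegative, so all terms of Im s carry the sign of ω and any
single one is a lower bound. -/
theorem le_abs_symbol_im {N : ℕ} {α : Fin N → ℝ} (hpos : ∀ k, 0 < α k) (hle : ∀ k, α k ≤ 2)
    {ω : ℝ} (hω : ω ≠ 0) (j : Fin N) :
    |ω| ^ α j * Real.sin (α j * (Real.pi / 2)) ≤ |(symbol α ω).im| := by
  have h : (symbol α ω).im
      = (SignType.sign ω : ℝ) * ∑ k, |ω| ^ α k * Real.sin (α k * (Real.pi / 2)) := by
    unfold symbol
    rw [Complex.im_sum, Finset.mul_sum]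
    refine Finset.sum_congr rfl fun k _ => ?_
    rw [I_mul_cpow hω, Complex.add_im, Complex.ofReal_im, Complex.im_ofReal_mul, Complex.I_im]
    ring
  have hs : |(SignType.sign ω : ℝ)| = 1 := by
    rcases lt_or_gt_of_ne hω with h | h
    · simp [sign_neg h]
    · simp [sign_pos h]
  have hnn : ∀ k, 0 ≤ |ω| ^ α k * Real.sin (α k * (Real.pi / 2)) := fun k =>
    mul_nonneg (by positivity) (sin_mul_pi_div_two_nonneg (hpos k) (hle k))
  rw [h, abs_mul, hs, one_mul, abs_of_nonneg (Finset.sum_nonneg fun k _ => hnn k)]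
  exact Finset.single_le_sum (f := fun k => |ω| ^ α k * Real.sin (α k * (Real.pi / 2)))
    (fun k _ => hnn k) (Finset.mem_univ j)

theorem norm_symbol_le {n : ℕ} {α : Fin (n + 1) → ℝ} (hmono : StrictMono α) {ω : ℝ}
    (hω : 1 ≤ |ω|) : ‖symbol α ω‖ ≤ (n + 1) * |ω| ^ α (Fin.last n) := by
  have h0 : ω ≠ 0 := abs_pos.1 (by linarith)
  calc ‖symbol α ω‖ ≤ ∑ k : Fin (n + 1), |ω| ^ α (Fin.last n) := by
        refine norm_sum_le_of_le _ fun k _ => ?_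
        rw [Complex.norm_cpow_real, norm_mul, Complex.norm_I, one_mul, Complex.norm_real,
          Real.norm_eq_abs]
        exact Real.rpow_le_rpow_of_exponent_le hω (hmono.monotone (Fin.le_last k))
    _ = _ := by simp

theorem sqrtSymbol_sq {N : ℕ} (α : Fin N → ℝ) (ω : ℝ) :
    sqrtSymbol α ω ^ 2 = symbol α ω := by
  have := Complex.cpow_nat_inv_pow (symbol α ω) (n := 2) two_ne_zero
  unfold sqrtSymbol
  rw [one_div]
  exact_mod_cast this

theorem sqrtSymbol_re_nonneg {N : ℕ} (α : Fin N → ℝ) (ω : ℝ) : 0 ≤ (sqrtSymbol α ω).re := by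
  unfold sqrtSymbol
  rw [show (1 / 2 : ℂ) = ((1 / 2 : ℝ) : ℂ) by push_cast; rfl, Complex.cpow_ofReal_re]
  have h1 := Complex.neg_pi_lt_arg (symbol α ω)
  have h2 := Complex.arg_le_pi (symbol α ω)
  exact mul_nonneg (by positivity) (Real.cos_nonneg_of_neg_pi_div_two_le_of_le (by linarith)
    (by linarith))

/-- From Im z² = 2 Re z Im z. It turns a lower bound for |Im s| into one for Re z |z|. -/
theorem abs_symbol_im_le {N : ℕ} (α : Fin N → ℝ) (ω : ℝ) :
    |(symbol α ω).im| ≤ 2 * (sqrtSymbol α ω).re * ‖sqrtSymbol α ω‖ := by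
  have h0 := sqrtSymbol_re_nonneg α ω
  rw [← sqrtSymbol_sq, sq, Complex.mul_im]
  have h : |(sqrtSymbol α ω).im| ≤ ‖sqrtSymbol α ω‖ := Complex.abs_im_le_norm _
  calc _ = 2 * (sqrtSymbol α ω).re * |(sqrtSymbol α ω).im| := by
        rw [show (sqrtSymbol α ω).re * (sqrtSymbol α ω).im
          + (sqrtSymbol α ω).im * (sqrtSymbol α ω).re
          = 2 * (sqrtSymbol α ω).re * (sqrtSymbol α ω).im by ring, abs_mul,
          abs_of_nonneg (by positivity : 0 ≤ 2 * (sqrtSymbol α ω).re)]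
    _ ≤ _ := by gcongr

theorem norm_sqrtSymbol_sq {N : ℕ} (α : Fin N → ℝ) (ω : ℝ) :
    ‖sqrtSymbol α ω‖ ^ 2 = ‖symbol α ω‖ := by
  rw [← norm_pow, sqrtSymbol_sq]

/-! ### The boundary trace of the Green function -/

/-- The solution `y ↦ G(0,y)` of `G'' = z² G`, `G(1) = 0`, `G'(0) = 1`. -/
def greenTrace (z : ℂ) (y : ℝ) : ℂ :=
  (Complex.exp (z * y) - Complex.exp (z * (2 - y))) / (z * (1 + Complex.exp (2 * z)))

/-- The derivative of `greenTrace`. -/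
def greenTraceDeriv (z : ℂ) (y : ℝ) : ℂ :=
  (z * Complex.exp (z * y) + z * Complex.exp (z * (2 - y))) / (z * (1 + Complex.exp (2 * z)))

theorem hasDerivAt_greenTrace (z : ℂ) (y : ℝ) :
    HasDerivAt (greenTrace z) (greenTraceDeriv z y) y := by
  have h1 : HasDerivAt (fun y : ℝ => Complex.exp (z * y)) (Complex.exp (z * y) * (z * 1)) y :=
    ((Complex.ofRealCLM.hasDerivAt (x := y)).const_mul z).cexp
  have h2 : HasDerivAt (fun y : ℝ => Complex.exp (z * (2 - y)))
      (Complex.exp (z * (2 - y)) * (z * -1)) y :=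
    (((Complex.ofRealCLM.hasDerivAt (x := y)).const_sub 2).const_mul z).cexp
  unfold greenTrace greenTraceDeriv
  convert! (h1.sub h2).div_const (z * (1 + Complex.exp (2 * z))) using 2
  ring

theorem continuous_greenTraceDeriv (z : ℂ) : Continuous (greenTraceDeriv z) := by
  unfold greenTraceDeriv; fun_prop

theorem zeroExt_green {N : ℕ} (α : Fin N → ℝ) {ω : ℝ} (hω : ω ≠ 0) :
    zeroExt (green α ω 0) = zeroExt (greenTrace (sqrtSymbol α ω)) := by
  ext y
  unfold zeroExt
  by_cases hy : y ∈ Set.Ioo (0 : ℝ) 1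
  · rw [Set.indicator_of_mem hy, Set.indicator_of_mem hy]
    simp only [green, hω, if_false, zero_sub, abs_neg, abs_of_pos hy.1, greenTrace,
      Complex.ofReal_zero, zero_add, sub_zero]
    -- At x = 0 and y > 0 the four exponentials coincide in pairs, which accounts for the factor 2.
    rw [← mul_div_mul_left (Complex.exp _ - Complex.exp _) _ (two_ne_zero' ℂ)]
    congr 1 <;> ring
  · rw [Set.indicator_of_notMem hy, Set.indicator_of_notMem hy]

theorem exists_hasDerivAt_zeroExt_green {N : ℕ} (α : Fin N → ℝ) (ω : ℝ) :
    ∃ g g' : ℝ → ℂ, (∀ y, HasDerivAt g (g' y) y) ∧ Continuous g' ∧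
      zeroExt (green α ω 0) = zeroExt g := by
  by_cases hω : ω = 0
  · refine ⟨fun y => (y : ℂ) - 1, fun _ => 1, fun y => ?_, continuous_const, ?_⟩
    · exact (Complex.ofRealCLM.hasDerivAt (x := y)).sub_const 1
    · ext y
      unfold zeroExt
      by_cases hy : y ∈ Set.Ioo (0 : ℝ) 1
      · rw [Set.indicator_of_mem hy, Set.indicator_of_mem hy]
        simp [green, hω, max_eq_right hy.1.le]
      · rw [Set.indicator_of_notMem hy, Set.indicator_of_notMem hy]
  · exact ⟨_, _, hasDerivAt_greenTrace _, continuous_greenTraceDeriv _, zeroExt_green α hω⟩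

theorem exp_two_mul_sub_one_le_norm (z : ℂ) :
    Real.exp (2 * z.re) - 1 ≤ ‖1 + Complex.exp (2 * z)‖ := by
  have h : ‖Complex.exp (2 * z)‖ = Real.exp (2 * z.re) := by
    rw [Complex.norm_exp]; simp
  have := norm_sub_norm_le (Complex.exp (2 * z)) (-1)
  rw [norm_neg, norm_one, h, sub_neg_eq_add, add_comm] at this
  exact this

theorem norm_exp_mul_ofReal (z : ℂ) (y : ℝ) : ‖Complex.exp (z * y)‖ = Real.exp (z.re * y) := by
  rw [Complex.norm_exp, Complex.re_mul_ofReal]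

theorem norm_exp_mul_two_sub (z : ℂ) (y : ℝ) :
    ‖Complex.exp (z * (2 - y))‖ = Real.exp (z.re * (2 - y)) := by
  rw [← norm_exp_mul_ofReal]; push_cast; rfl

/-- With t = 2 Re z, the quotient is at most 2eᵗ/(|z|(eᵗ - 1)), and eᵗ/(eᵗ - 1) ≤ 1 + 1/t. -/
theorem norm_greenTrace_le {z : ℂ} (hz : 0 < z.re) {y : ℝ} (hy : y ∈ Set.Icc (0 : ℝ) 1) :
    ‖greenTrace z y‖ ≤ (2 + 1 / z.re) / ‖z‖ := by
  have hz0 : 0 < ‖z‖ := hz.trans_le (Complex.re_le_norm z)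
  have hE : 0 < Real.exp (2 * z.re) - 1 := by
    have := Real.add_one_le_exp (2 * z.re); linarith
  have hnum : ‖Complex.exp (z * y) - Complex.exp (z * (2 - y))‖ ≤ 2 * Real.exp (2 * z.re) := by
    refine (norm_sub_le _ _).trans ?_
    rw [norm_exp_mul_ofReal, norm_exp_mul_two_sub, two_mul]
    exact add_le_add (Real.exp_le_exp.2 (by nlinarith [hy.1, hy.2]))
      (Real.exp_le_exp.2 (by nlinarith [hy.1, hy.2]))
  unfold greenTrace
  rw [norm_div, norm_mul]
  calc _ ≤ 2 * Real.exp (2 * z.re) / (‖z‖ * (Real.exp (2 * z.re) - 1)) := by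
        gcongr; exact exp_two_mul_sub_one_le_norm z
    _ ≤ _ := by
        rw [div_le_div_iff₀ (by positivity) hz0]
        have h1 : 2 * Real.exp (2 * z.re) ≤ (2 + 1 / z.re) * (Real.exp (2 * z.re) - 1) := by
          have h2 : 2 * z.re ≤ Real.exp (2 * z.re) - 1 := by
            linarith [Real.add_one_le_exp (2 * z.re)]
          have h3 : 2 ≤ 1 / z.re * (Real.exp (2 * z.re) - 1) := by
            rw [one_div, ← div_eq_inv_mul, le_div_iff₀ hz]; exact h2
          linarith
        nlinarith

/-- The pointwise majorant f has the explicit antiderivative F, with F(1) = 0 and F(0) = -1/Re z. -/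
theorem integral_norm_greenTraceDeriv_le {z : ℂ} (hz : 0 < z.re) :
    ∫ y in (0 : ℝ)..1, ‖greenTraceDeriv z y‖ ≤ 1 / z.re := by
  have hz0 : 0 < ‖z‖ := hz.trans_le (Complex.re_le_norm z)
  have hE : 0 < Real.exp (2 * z.re) - 1 := by
    have := Real.add_one_le_exp (2 * z.re); linarith
  set F : ℝ → ℝ := fun y => (Real.exp (z.re * y) - Real.exp (z.re * (2 - y)))
    / (z.re * (Real.exp (2 * z.re) - 1)) with hF
  set f : ℝ → ℝ := fun y => (Real.exp (z.re * y) + Real.exp (z.re * (2 - y)))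
    / (Real.exp (2 * z.re) - 1) with hf
  have hder : ∀ y, HasDerivAt F (f y) y := by
    intro y
    have h1 : HasDerivAt (fun y : ℝ => Real.exp (z.re * y)) (Real.exp (z.re * y) * (z.re * 1)) y :=
      ((hasDerivAt_id y).const_mul z.re).exp
    have h2 : HasDerivAt (fun y : ℝ => Real.exp (z.re * (2 - y)))
        (Real.exp (z.re * (2 - y)) * (z.re * -1)) y :=
      (((hasDerivAt_id y).const_sub 2).const_mul z.re).exp
    convert! (h1.sub h2).div_const (z.re * (Real.exp (2 * z.re) - 1)) using 1
    rw [hf]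
    field_simp
    ring
  have hfc : Continuous f := by rw [hf]; fun_prop
  have hle : ∀ y, ‖greenTraceDeriv z y‖ ≤ f y := by
    intro y
    have hzne : z ≠ 0 := norm_pos_iff.1 hz0
    have : greenTraceDeriv z y
        = (Complex.exp (z * y) + Complex.exp (z * (2 - y))) / (1 + Complex.exp (2 * z)) := by
      unfold greenTraceDeriv
      rw [← mul_add, mul_div_mul_left _ _ hzne]
    rw [this, norm_div]
    have h1 : ‖Complex.exp (z * y) + Complex.exp (z * (2 - y))‖
        ≤ Real.exp (z.re * y) + Real.exp (z.re * (2 - y)) := by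
      rw [← norm_exp_mul_ofReal, ← norm_exp_mul_two_sub]; exact norm_add_le _ _
    have h2 := exp_two_mul_sub_one_le_norm z
    rw [hf]
    dsimp only
    gcongr
  calc ∫ y in (0 : ℝ)..1, ‖greenTraceDeriv z y‖ ≤ ∫ y in (0 : ℝ)..1, f y :=
        intervalIntegral.integral_mono_on zero_le_one
          ((continuous_greenTraceDeriv z).norm.intervalIntegrable _ _)
          (hfc.intervalIntegrable _ _) fun y _ => hle y
    _ = F 1 - F 0 := intervalIntegral.integral_eq_sub_of_hasDerivAt (fun y _ => hder y)
        (hfc.intervalIntegrable _ _)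
    _ = 1 / z.re := by
        rw [hF]
        have : (2 : ℝ) - 1 = 1 := by norm_num
        simp only [this, mul_one, sub_self, zero_div, mul_zero, Real.exp_zero, sub_zero]
        rw [mul_comm z.re 2]
        field_simp
        ring

/-! ### Decay of the second moment -/

theorem exists_eq_alphaMax {n : ℕ} {α : Fin (n + 1) → ℝ} (hfirst : α 0 < 2) :
    ∃ j, α j ≠ 2 ∧ α j = alphaMax α := by
  have hfin : {a : ℝ | a ≠ 2 ∧ ∃ i, α i = a}.Finite :=
    (Set.finite_range α).subset fun a ha => ha.2
  have hne : {a : ℝ | a ≠ 2 ∧ ∃ i, α i = a}.Nonempty := ⟨α 0, hfirst.ne, 0, rfl⟩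
  obtain ⟨h2, j, hj⟩ := hne.csSup_mem hfin
  exact ⟨j, by rwa [hj], hj⟩

theorem sqrtSymbol_re_pos {N : ℕ} {α : Fin N → ℝ} (hpos : ∀ k, 0 < α k) (hle : ∀ k, α k ≤ 2)
    {ω : ℝ} (hω : ω ≠ 0) {j : Fin N} (hj : α j < 2) : 0 < (sqrtSymbol α ω).re := by
  have h1 : 0 < |ω| ^ α j * Real.sin (α j * (Real.pi / 2)) :=
    mul_pos (Real.rpow_pos_of_pos (abs_pos.2 hω) _) (sin_mul_pi_div_two_pos (hpos j) hj)
  have h2 := (h1.trans_le (le_abs_symbol_im hpos hle hω j)).trans_le (abs_symbol_im_le α ω)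
  refine (sqrtSymbol_re_nonneg α ω).lt_of_ne fun h => ?_
  rw [← h] at h2
  simp at h2

/-- Write p = |ω|^{α j}, c for the sine, x = Re z, r = |z|. Then pc ≤ r² and pc ≤ 2xr, and the
square is at most 8/r² + 2/(xr)². The second term gives p⁻², reduced to p⁻¹ by p ≥ 1. -/
theorem norm_greenTrace_sq_le {N : ℕ} {α : Fin N → ℝ} (hpos : ∀ k, 0 < α k)
    (hle : ∀ k, α k ≤ 2) {ω : ℝ} (hω : 1 ≤ |ω|) {j : Fin N} (hj : α j < 2) :
    ((2 + 1 / (sqrtSymbol α ω).re) / ‖sqrtSymbol α ω‖) ^ 2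
      ≤ (8 / Real.sin (α j * (Real.pi / 2)) + 8 / Real.sin (α j * (Real.pi / 2)) ^ 2)
        * |ω| ^ (-α j) := by
  have hω0 : ω ≠ 0 := abs_pos.1 (by linarith)
  have ha : 0 < |ω| := abs_pos.2 hω0
  have hx := sqrtSymbol_re_pos hpos hle hω0 hj
  have hz : 0 < ‖sqrtSymbol α ω‖ := hx.trans_le (Complex.re_le_norm _)
  have hc := sin_mul_pi_div_two_pos (hpos j) hj
  have hp : 1 ≤ |ω| ^ α j := Real.one_le_rpow hω (hpos j).le
  have hT := le_abs_symbol_im hpos hle hω0 j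
  have hT1 := hT.trans (abs_symbol_im_le α ω)
  have hT2 : |ω| ^ α j * Real.sin (α j * (Real.pi / 2)) ≤ ‖sqrtSymbol α ω‖ ^ 2 := by
    rw [norm_sqrtSymbol_sq]; exact hT.trans (Complex.abs_im_le_norm _)
  rw [Real.rpow_neg ha.le]
  generalize Real.sin (α j * (Real.pi / 2)) = c at *
  generalize |ω| ^ α j = p at *
  generalize ‖sqrtSymbol α ω‖ = r at *
  generalize (sqrtSymbol α ω).re = x at *
  have hpc : 0 < p * c := by positivity
  have e1 : (1 / r) ^ 2 ≤ 1 / (p * c) := by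
    rw [div_pow, one_pow]; exact one_div_le_one_div_of_le hpc hT2
  have e2 : 1 / (x * r) ≤ 2 / (p * c) := by
    rw [div_le_div_iff₀ (by positivity) hpc]; linarith
  have e3 : (1 / (x * r)) ^ 2 ≤ 4 / (p * c ^ 2) := by
    calc (1 / (x * r)) ^ 2 ≤ (2 / (p * c)) ^ 2 := by gcongr
      _ = 4 / (p * (p * c ^ 2)) := by field_simp; norm_num
      _ ≤ 4 / (1 * (p * c ^ 2)) := by gcongr
      _ = _ := by rw [one_mul]
  calc ((2 + 1 / x) / r) ^ 2 = (2 * (1 / r) + 1 / (x * r)) ^ 2 := by congr 1; field_simp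
    _ ≤ 8 * (1 / r) ^ 2 + 2 * (1 / (x * r)) ^ 2 := by
        nlinarith [sq_nonneg (2 * (1 / r) - 1 / (x * r))]
    _ ≤ 8 * (1 / (p * c)) + 2 * (4 / (p * c ^ 2)) := by gcongr
    _ = _ := by field_simp; ring

/-- When the top order is below 2, |Im s| and |s| grow at the same rate p = |ω|^{α_n}, so (pc)² ≤ 4
(Re z)² |s| ≤ 4 (Re z)² (n+1) p. -/
theorem sq_le_sqrtSymbol_re_sq {n : ℕ} {α : Fin (n + 1) → ℝ} (hmono : StrictMono α)
    (hpos : ∀ k, 0 < α k) (hlast : α (Fin.last n) < 2) {ω : ℝ} (hω : 1 ≤ |ω|) :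
    Real.sin (α (Fin.last n) * (Real.pi / 2)) ^ 2 / (4 * (n + 1)) * |ω| ^ α (Fin.last n)
      ≤ (sqrtSymbol α ω).re ^ 2 := by
  have hle : ∀ k, α k ≤ 2 := fun k => (hmono.monotone (Fin.le_last k)).trans hlast.le
  have hω0 : ω ≠ 0 := abs_pos.1 (by linarith)
  have hc := sin_mul_pi_div_two_pos (hpos _) hlast
  have hp : 0 < |ω| ^ α (Fin.last n) := Real.rpow_pos_of_pos (abs_pos.2 hω0) _
  have hT := (le_abs_symbol_im hpos hle hω0 (Fin.last n)).trans (abs_symbol_im_le α ω)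
  have hs := norm_symbol_le hmono hω
  rw [← norm_sqrtSymbol_sq] at hs
  generalize Real.sin (α (Fin.last n) * (Real.pi / 2)) = c at *
  generalize |ω| ^ α (Fin.last n) = p at *
  generalize ‖sqrtSymbol α ω‖ = r at *
  generalize (sqrtSymbol α ω).re = x at *
  have h1 : (p * c) ^ 2 ≤ (2 * x * r) ^ 2 := by gcongr
  have h2 : (p * c) ^ 2 ≤ 4 * x ^ 2 * ((n + 1) * p) := by
    calc _ ≤ _ := h1
      _ = 4 * x ^ 2 * r ^ 2 := by ring
      _ ≤ _ := by gcongr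
  have h3 : p * c ^ 2 ≤ 4 * x ^ 2 * (n + 1) := by
    refine le_of_mul_le_mul_left ?_ hp
    linarith
  rw [div_mul_eq_mul_div, div_le_iff₀ (by positivity)]
  linarith

theorem tendsto_sqrtSymbol_re {n : ℕ} {α : Fin (n + 1) → ℝ} (hmono : StrictMono α)
    (hpos : ∀ k, 0 < α k) (hlast : α (Fin.last n) < 2) :
    Tendsto (fun ω => (sqrtSymbol α ω).re) (comap (fun ω : ℝ => |ω|) atTop) atTop := by
  have hc := sin_mul_pi_div_two_pos (hpos _) hlast
  have h1 : Tendsto (fun ω : ℝ => Real.sin (α (Fin.last n) * (Real.pi / 2)) ^ 2 / (4 * (n + 1))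
      * |ω| ^ α (Fin.last n)) (comap (fun ω : ℝ => |ω|) atTop) atTop :=
    ((tendsto_rpow_atTop (hpos (Fin.last n))).comp tendsto_comap).const_mul_atTop (by positivity)
  have hev : ∀ᶠ ω : ℝ in comap (fun ω : ℝ => |ω|) atTop, 1 ≤ |ω| :=
    tendsto_comap.eventually (eventually_ge_atTop 1)
  have h2 : Tendsto (fun ω => (sqrtSymbol α ω).re ^ 2) (comap (fun ω : ℝ => |ω|) atTop) atTop :=
    tendsto_atTop_mono' _ (hev.mono fun ω hω => sq_le_sqrtSymbol_re_sq hmono hpos hlast hω) h1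
  refine (Real.tendsto_sqrt_atTop.comp h2).congr fun ω => ?_
  exact Real.sqrt_sq (sqrtSymbol_re_nonneg α ω)

section Wiener

variable {Ω : Type*} [MeasurableSpace Ω] {P : Measure Ω} {H : ℝ} {B : ℝ → Ω → ℝ}

theorem exists_isWienerIntegral_green (hH0 : 0 < H) (hH1 : H < 1) (hB : IsFBM P H B) {N : ℕ}
    (α : Fin N → ℝ) (ω : ℝ) : ∃ I, IsWienerIntegral P H B (green α ω 0) I := by
  obtain ⟨g, g', hg, hg', he⟩ := exists_hasDerivAt_zeroExt_green α ω
  obtain ⟨I, hI, -⟩ := exists_isWienerIntegral_of_hasDerivAt hH0 hH1 hB hg hg'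
  exact ⟨I, hI.congr he.symm⟩

theorem isWienerIntegral_wienerIntegral_green (hH0 : 0 < H) (hH1 : H < 1) (hB : IsFBM P H B)
    {N : ℕ} (α : Fin N → ℝ) (ω : ℝ) :
    IsWienerIntegral P H B (green α ω 0) (wienerIntegral P H B (green α ω 0)) := by
  have h := exists_isWienerIntegral_green hH0 hH1 hB α ω
  unfold wienerIntegral
  rw [dif_pos h]
  exact h.choose_spec

theorem R_nonneg {N : ℕ} (α : Fin N → ℝ) (ω : ℝ) : 0 ≤ R P H B α ω :=
  integral_nonneg fun _ => by positivity

/-- The constant in the decay estimate for `H ≥ 1/2`. -/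
def decayConst {N : ℕ} (H : ℝ) (α : Fin N → ℝ) : ℝ :=
  supBoundConst H * (8 / Real.sin (alphaMax α * (Real.pi / 2))
    + 8 / Real.sin (alphaMax α * (Real.pi / 2)) ^ 2)

theorem R_le_decayConst_mul {n : ℕ} {α : Fin (n + 1) → ℝ} (hpos : ∀ k, 0 < α k)
    (hle : ∀ k, α k ≤ 2) (hfirst : α 0 < 2) (hH : 1 / 2 ≤ H) (hH1 : H < 1) (hB : IsFBM P H B)
    {ω : ℝ} (hω : 1 < |ω|) : R P H B α ω ≤ decayConst H α * |ω| ^ (-alphaMax α) := by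
  obtain ⟨j, hj2, hj⟩ := exists_eq_alphaMax hfirst
  have hj2 : α j < 2 := lt_of_le_of_ne (hle j) hj2
  have hH0 : 0 < H := by linarith
  have hω0 : ω ≠ 0 := abs_pos.1 (by linarith)
  have hx := sqrtSymbol_re_pos hpos hle hω0 hj2
  have hI := isWienerIntegral_wienerIntegral_green hH0 hH1 hB α ω
  have hb := (hI.congr (zeroExt_green α hω0)).eLpNorm_sq_le_of_norm_le hH hH1 hB
    (hasDerivAt_greenTrace _) (continuous_greenTraceDeriv _) fun y hy => norm_greenTrace_le hx hy
  have hs := supBoundConst_nonneg hH0 hH1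
  refine (integral_norm_sq_le_of_eLpNorm hI.2.1 (by positivity) hb).trans ?_
  rw [decayConst, ← hj, mul_assoc]
  exact mul_le_mul_of_nonneg_left (norm_greenTrace_sq_le hpos hle hω.le hj2) hs

/-- The zero extension has jumps at 0 and 1, each at most the sup norm, plus variation at most 1/Re
z inside. The bound is small only when Re z is large. -/
theorem R_le_of_sqrtSymbol_re_pos (hH0 : 0 < H) (hH1 : H < 1) (hB : IsFBM P H B) {N : ℕ}
    {α : Fin N → ℝ} {ω : ℝ} (hω : ω ≠ 0) (hx : 0 < (sqrtSymbol α ω).re) :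
    R P H B α ω ≤ (energyConst H).toReal * (2 * (2 * (2 * ((2 + 1 / (sqrtSymbol α ω).re)
      / (sqrtSymbol α ω).re) + 1 / (sqrtSymbol α ω).re) ^ 2 * sobolevTailConst H)) := by
  have hI := isWienerIntegral_wienerIntegral_green hH0 hH1 hB α ω
  have hb := (hI.congr (zeroExt_green α hω)).eLpNorm_sq_le hH0 hH1 hB
  have hsup : ∀ y ∈ Set.Icc (0 : ℝ) 1, ‖greenTrace (sqrtSymbol α ω) y‖
      ≤ (2 + 1 / (sqrtSymbol α ω).re) / (sqrtSymbol α ω).re := by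
    intro y hy
    refine (norm_greenTrace_le hx hy).trans ?_
    gcongr
    exact Complex.re_le_norm _
  have hx1 : 0 < 1 / (sqrtSymbol α ω).re := by positivity
  have hx2 : 0 < (2 + 1 / (sqrtSymbol α ω).re) / (sqrtSymbol α ω).re := by positivity
  have hsob := sobolevNormSq_zeroExt_le hH0 (hasDerivAt_greenTrace (sqrtSymbol α ω))
    (continuous_greenTraceDeriv _) (A := 2 * ((2 + 1 / (sqrtSymbol α ω).re)
      / (sqrtSymbol α ω).re) + 1 / (sqrtSymbol α ω).re)
    (fun y hy => (hsup y hy).trans (by linarith))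
    (by linarith [hsup 0 (by simp), hsup 1 (by simp), integral_norm_greenTraceDeriv_le hx])
  have hC := sobolevTailConst_nonneg H
  refine integral_norm_sq_le_of_eLpNorm hI.2.1 (by positivity) (hb.trans ?_)
  rw [ENNReal.ofReal_mul ENNReal.toReal_nonneg, ENNReal.ofReal_toReal (energyConst_ne_top H),
    ENNReal.ofReal_mul zero_le_two, ENNReal.ofReal_ofNat]
  gcongr

theorem tendsto_R_of_last_lt_two (hH0 : 0 < H) (hH1 : H < 1) (hB : IsFBM P H B) {n : ℕ}
    {α : Fin (n + 1) → ℝ} (hmono : StrictMono α) (hpos : ∀ k, 0 < α k)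
    (hlast : α (Fin.last n) < 2) :
    Tendsto (R P H B α) (comap (fun ω : ℝ => |ω|) atTop) (𝓝 0) := by
  have hx := tendsto_sqrtSymbol_re hmono hpos hlast
  have hinv := hx.inv_tendsto_atTop
  simp only [Pi.inv_def] at hinv
  have hlim := ((((((hinv.const_add 2).mul hinv).const_mul 2).add hinv).pow 2).const_mul 2).mul_const
    (sobolevTailConst H)
  have hlim2 := (hlim.const_mul 2).const_mul (energyConst H).toReal
  simp only [mul_zero, add_zero, ne_eq, OfNat.ofNat_ne_zero, not_false_eq_true, zero_pow,
    zero_mul] at hlim2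
  refine squeeze_zero' (Eventually.of_forall fun ω => R_nonneg α ω) ?_ hlim2
  filter_upwards [tendsto_comap.eventually (eventually_ge_atTop (1 : ℝ)),
    hx.eventually_gt_atTop 0] with ω hω hxω
  have h := R_le_of_sqrtSymbol_re_pos hH0 hH1 hB (abs_pos.1 (by linarith)) hxω
  simpa only [one_div, div_eq_mul_inv, one_mul] using h

theorem tendsto_R_of_half_le {n : ℕ} {α : Fin (n + 1) → ℝ} (hpos : ∀ k, 0 < α k)
    (hle : ∀ k, α k ≤ 2) (hfirst : α 0 < 2) (hH : 1 / 2 ≤ H) (hH1 : H < 1) (hB : IsFBM P H B) :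
    Tendsto (R P H B α) (comap (fun ω : ℝ => |ω|) atTop) (𝓝 0) := by
  obtain ⟨j, -, hj⟩ := exists_eq_alphaMax hfirst
  have hlim := ((tendsto_rpow_neg_atTop (hj ▸ hpos j)).comp
    (tendsto_comap (f := fun ω : ℝ => |ω|))).const_mul (decayConst H α)
  rw [mul_zero] at hlim
  refine squeeze_zero' (Eventually.of_forall fun ω => R_nonneg α ω) ?_ hlim
  filter_upwards [tendsto_comap.eventually (eventually_gt_atTop (1 : ℝ))] with ω hω
  exact R_le_decayConst_mul hpos hle hfirst hH hH1 hB hω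

/-! ### Instability -/

theorem cVariance_nonneg (X : Ω → ℂ) : 0 ≤ cVariance P X :=
  integral_nonneg fun _ => by positivity

theorem cVariance_const_mul (c : ℂ) (X : Ω → ℂ) :
    cVariance P (fun o => c * X o) = ‖c‖ ^ 2 * cVariance P X := by
  unfold cVariance
  rw [← integral_const_mul, integral_const_mul]
  congr 1; ext o
  rw [← mul_sub, norm_mul, mul_pow]

/-- The constant 4 is crude, from |a - b|² ≤ 2|a|² + 2|b|²; only the vanishing of the right side
matters later. -/
theorem cVariance_le [IsProbabilityMeasure P] {X : Ω → ℂ} (hX : MemLp X 2 P) :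
    cVariance P X ≤ 4 * ∫ o, ‖X o‖ ^ 2 ∂P := by
  have hi := (memLp_two_iff_integrable_sq_norm hX.1).1 hX
  have hm : ‖∫ o, X o ∂P‖ ^ 2 ≤ ∫ o, ‖X o‖ ^ 2 ∂P :=
    (by gcongr; exact norm_integral_le_integral_norm _ :
      ‖∫ o, X o ∂P‖ ^ 2 ≤ (∫ o, ‖X o‖ ∂P) ^ 2).trans (sq_integral_le_integral_sq hX.norm)
  calc cVariance P X ≤ ∫ o, (2 * ‖X o‖ ^ 2 + 2 * ‖∫ o', X o' ∂P‖ ^ 2) ∂P := by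
        refine integral_mono_of_nonneg (ae_of_all _ fun _ => by positivity)
          ((hi.const_mul 2).add (integrable_const _)) (ae_of_all _ fun o => ?_)
        have := norm_sub_le (X o) (∫ o', X o' ∂P)
        dsimp only
        nlinarith [sq_nonneg (‖X o‖ - ‖∫ o', X o' ∂P‖), norm_nonneg (X o - ∫ o', X o' ∂P),
          norm_nonneg (X o), norm_nonneg (∫ o', X o' ∂P)]
    _ = 2 * ∫ o, ‖X o‖ ^ 2 ∂P + 2 * ‖∫ o', X o' ∂P‖ ^ 2 := by
        rw [integral_add (hi.const_mul 2) (integrable_const _), integral_const_mul]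
        simp
    _ ≤ _ := by linarith

theorem cVariance_boundaryValue {N : ℕ} (α : Fin N → ℝ) (f : ℝ → ℝ) (ω : ℝ) :
    cVariance P (boundaryValue P H B α f ω) = ‖fourierT (fun t => (f t : ℂ)) ω‖ ^ 2
      * cVariance P (wienerIntegral P H B (green α ω 0)) := by
  have := cVariance_const_mul (P := P) (-(fourierT (fun t => (f t : ℂ)) ω))
    (wienerIntegral P H B (green α ω 0))
  rwa [norm_neg] at this

end Wiener

theorem fourierT_const_mul (c : ℂ) (v : ℝ → ℂ) (ζ : ℝ) :
    fourierT (fun t => c * v t) ζ = c * fourierT v ζ := by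
  unfold fourierT
  rw [← integral_const_mul]
  simp only [mul_assoc]

/-- For a bump b around 1, the transform of b e^{iωt} at ω is ∫ b > 0, so b cos(ωt) and b sin(ωt)
cannot both have zero transform there. The split keeps the function real. -/
theorem exists_contDiff_fourierT_ne_zero (ω : ℝ) :
    ∃ ψ : ℝ → ℝ, ContDiff ℝ (⊤ : ℕ∞) ψ ∧ HasCompactSupport ψ ∧ tsupport ψ ⊆ Set.Ioi 0 ∧
      fourierT (fun t => (ψ t : ℂ)) ω ≠ 0 := by
  let b : ContDiffBump (1 : ℝ) := ⟨1 / 4, 1 / 2, by norm_num, by norm_num⟩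
  have hb : ContDiff ℝ (⊤ : ℕ∞) b := b.contDiff
  have hsupp : tsupport b ⊆ Set.Ioi 0 := by
    rw [b.tsupport_eq]
    intro t ht
    have h := (abs_le.1 (by simpa [Real.dist_eq] using ht : |t - 1| ≤ b.rOut)).1
    change -(1 / 2 : ℝ) ≤ t - 1 at h
    rw [Set.mem_Ioi]
    linarith
  have key : ∀ h : ℝ → ℝ, ContDiff ℝ (⊤ : ℕ∞) h →
      ContDiff ℝ (⊤ : ℕ∞) (fun t => b t * h t) ∧ HasCompactSupport (fun t => b t * h t) ∧
        tsupport (fun t => b t * h t) ⊆ Set.Ioi 0 := fun h hh =>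
    ⟨hb.mul hh, b.hasCompactSupport.mul_right, (tsupport_mul_subset_left).trans hsupp⟩
  have hc := key (fun t => Real.cos (ω * t)) (by fun_prop)
  have hs := key (fun t => Real.sin (ω * t)) (by fun_prop)
  by_cases h0 : fourierT (fun t => ((b t * Real.cos (ω * t) : ℝ) : ℂ)) ω = 0
  · refine ⟨_, hs.1, hs.2.1, hs.2.2, fun h1 => ?_⟩
    have hci : Integrable fun t => ((b t * Real.cos (ω * t) : ℝ) : ℂ) :=
      (hc.1.continuous.integrable_of_hasCompactSupport hc.2.1).ofReal
    have hsi : Integrable fun t => ((b t * Real.sin (ω * t) : ℝ) : ℂ) :=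
      (hs.1.continuous.integrable_of_hasCompactSupport hs.2.1).ofReal
    have hsum := fourierT_add hci (hsi.const_mul Complex.I) ω
    rw [fourierT_const_mul, h0, h1, mul_zero, add_zero] at hsum
    have hint : fourierT (fun t => ((b t * Real.cos (ω * t) : ℝ) : ℂ)
        + Complex.I * ((b t * Real.sin (ω * t) : ℝ) : ℂ)) ω = ((∫ t, b t : ℝ) : ℂ) := by
      unfold fourierT
      rw [← integral_complex_ofReal]
      congr 1; ext t
      have e1 : ((b t * Real.cos (ω * t) : ℝ) : ℂ) + Complex.I * ((b t * Real.sin (ω * t) : ℝ) : ℂ)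
          = b t * Complex.exp (Complex.I * ω * t) := by
        rw [show Complex.I * ω * t = ((ω * t : ℝ) : ℂ) * Complex.I by push_cast; ring,
          Complex.exp_mul_I, Complex.ofReal_mul, Complex.ofReal_mul, Complex.ofReal_cos,
          Complex.ofReal_sin]
        ring
      beta_reduce
      rw [e1, mul_assoc, ← Complex.exp_add, add_neg_cancel, Complex.exp_zero, mul_one]
    rw [hint] at hsum
    have hpos : 0 < ∫ t, b t := b.integral_pos
    exact hpos.ne' (by exact_mod_cast hsum)
  · exact ⟨_, hc.1, hc.2.1, hc.2.2, h0⟩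

theorem exists_contDiff_norm_fourierT_eq (ω : ℝ) {m : ℝ} (hm : 0 ≤ m) :
    ∃ φ : ℝ → ℝ, ContDiff ℝ (⊤ : ℕ∞) φ ∧ HasCompactSupport φ ∧ tsupport φ ⊆ Set.Ioi 0 ∧
      ‖fourierT (fun t => (φ t : ℂ)) ω‖ = m := by
  obtain ⟨ψ, h1, h2, h3, h4⟩ := exists_contDiff_fourierT_ne_zero ω
  refine ⟨fun t => m / ‖fourierT (fun t => (ψ t : ℂ)) ω‖ * ψ t, contDiff_const.mul h1,
    h2.mul_left, (tsupport_mul_subset_right).trans h3, ?_⟩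
  simp only [Complex.ofReal_mul]
  rw [fourierT_const_mul, norm_mul, Complex.norm_real, Real.norm_of_nonneg (by positivity),
    div_mul_cancel₀ _ (norm_ne_zero_iff.2 h4)]

theorem exists_perturbation_of_tendsto_R {Ω : Type*} [MeasurableSpace Ω] {P : Measure Ω}
    [IsProbabilityMeasure P] {H : ℝ} {B : ℝ → Ω → ℝ} (hH0 : 0 < H) (hH1 : H < 1)
    (hB : IsFBM P H B) {N : ℕ} {α : Fin N → ℝ}
    (hR : Tendsto (R P H B α) (comap (fun ω : ℝ => |ω|) atTop) (𝓝 0)) {f : ℝ → ℝ}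
    (hf : Integrable f) {M δ : ℝ} (hM : 0 < M) (hδ : 0 < δ) :
    ∃ W : ℝ, ∀ ω : ℝ, W < |ω| →
      ∃ φ : ℝ → ℝ, ContDiff ℝ (⊤ : ℕ∞) φ ∧ HasCompactSupport φ ∧ tsupport φ ⊆ Set.Ioi 0 ∧
        M ≤ |‖fourierT (fun t => ((f t + φ t : ℝ) : ℂ)) ω‖ - ‖fourierT (fun t => (f t : ℂ)) ω‖| ∧
        |cVariance P (boundaryValue P H B α (fun t => f t + φ t) ω)
          - cVariance P (boundaryValue P H B α f ω)| ≤ δ := by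
  set F : ℝ := ∫ t, ‖(f t : ℂ)‖ with hF
  have hF0 : 0 ≤ F := integral_nonneg fun _ => norm_nonneg _
  have hD : 0 < 4 * (F + (M + 2 * F)) ^ 2 := by positivity
  have hev := hR.eventually (gt_mem_nhds (div_pos hδ hD))
  rw [eventually_comap, eventually_atTop] at hev
  obtain ⟨W, hW⟩ := hev
  refine ⟨W, fun ω hω => ?_⟩
  -- |f̂ + φ̂| - |f̂| ≥ |φ̂| - 2|f̂| with |f̂| ≤ F, so size M + 2F guarantees a gap of at least M.
  obtain ⟨φ, h1, h2, h3, h4⟩ := exists_contDiff_norm_fourierT_eq ω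
    (by positivity : 0 ≤ M + 2 * F)
  have hRω := hW |ω| hω.le ω rfl
  have hadd : fourierT (fun t => ((f t + φ t : ℝ) : ℂ)) ω
      = fourierT (fun t => (f t : ℂ)) ω + fourierT (fun t => (φ t : ℂ)) ω := by
    have hfi : Integrable fun t => (f t : ℂ) := hf.ofReal
    have hφi : Integrable fun t => (φ t : ℂ) :=
      (h1.continuous.integrable_of_hasCompactSupport h2).ofReal
    rw [← fourierT_add hfi hφi]
    simp only [Complex.ofReal_add]
  have hfF : ‖fourierT (fun t => (f t : ℂ)) ω‖ ≤ F := norm_fourierT_le _ _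
  have hup := norm_add_le (fourierT (fun t => (f t : ℂ)) ω) (fourierT (fun t => (φ t : ℂ)) ω)
  have hlow := norm_sub_le (fourierT (fun t => (f t : ℂ)) ω + fourierT (fun t => (φ t : ℂ)) ω)
    (fourierT (fun t => (f t : ℂ)) ω)
  rw [add_sub_cancel_left] at hlow
  refine ⟨φ, h1, h2, h3, ?_, ?_⟩
  · rw [hadd]
    refine le_trans ?_ (le_abs_self _)
    linarith
  · rw [cVariance_boundaryValue, cVariance_boundaryValue, hadd, ← sub_mul, abs_mul,
      abs_of_nonneg (cVariance_nonneg _)]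
    have hV : cVariance P (wienerIntegral P H B (green α ω 0)) ≤ 4 * R P H B α ω :=
      cVariance_le (isWienerIntegral_wienerIntegral_green hH0 hH1 hB α ω).2.1
    have hsq : |‖fourierT (fun t => (f t : ℂ)) ω + fourierT (fun t => (φ t : ℂ)) ω‖ ^ 2
        - ‖fourierT (fun t => (f t : ℂ)) ω‖ ^ 2| ≤ (F + (M + 2 * F)) ^ 2 := by
      rw [abs_le]
      constructor <;> nlinarith [norm_nonneg (fourierT (fun t => (f t : ℂ)) ω),
        norm_nonneg (fourierT (fun t => (f t : ℂ)) ω + fourierT (fun t => (φ t : ℂ)) ω)]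
    calc _ ≤ (F + (M + 2 * F)) ^ 2 * (4 * (δ / (4 * (F + (M + 2 * F)) ^ 2))) := by
          gcongr
          · exact cVariance_nonneg _
          · exact hV.trans (by linarith)
      _ = δ := by
          have : F + (M + 2 * F) ≠ 0 := by positivity
          field_simp

end FracDiffusionWave

end

theorem mainTheorem2 {n : ℕ} (α : Fin (n + 1) → ℝ) (hmono : StrictMono α)
    (hpos : ∀ k, 0 < α k) (hle : ∀ k, α k ≤ 2) (hfirst : α 0 < 2)
    (H : ℝ) (hH0 : 0 < H) (hH1 : H < 1) :
    ∃ C : ℝ, 0 < C ∧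
      ∀ (Ω : Type*) [MeasurableSpace Ω] (P : Measure Ω) [IsProbabilityMeasure P]
        (B : ℝ → Ω → ℝ), FracDiffusionWave.IsFBM P H B →
        -- the stochastic integral exists and is unique up to null sets
        (∀ ω : ℝ, ∃ I : Ω → ℂ,
          FracDiffusionWave.IsWienerIntegral P H B (FracDiffusionWave.green α ω 0) I ∧
          ∀ J : Ω → ℂ,
            FracDiffusionWave.IsWienerIntegral P H B (FracDiffusionWave.green α ω 0) J →
              J =ᵐ[P] I) ∧
        (1 / 2 ≤ H → ∀ ω : ℝ, 1 < |ω| →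
          FracDiffusionWave.R P H B α ω ≤ C * |ω| ^ (-FracDiffusionWave.alphaMax α)) ∧
        (H < 1 / 2 → α (Fin.last n) < 2 →
          Tendsto (FracDiffusionWave.R P H B α) (comap (fun ω : ℝ => |ω|) atTop) (𝓝 0)) ∧
        -- instability of the recovery of `|f̂(ω)|` from the variance of the boundary data
        (1 / 2 ≤ H ∨ α (Fin.last n) < 2 →
          ∀ f : ℝ → ℝ, Integrable f → (∀ t ≤ 0, f t = 0) →
          ∀ M > 0, ∀ δ > 0, ∃ W : ℝ, ∀ ω : ℝ, W < |ω| →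
            ∃ φ : ℝ → ℝ, ContDiff ℝ (⊤ : ℕ∞) φ ∧ HasCompactSupport φ ∧ tsupport φ ⊆ Set.Ioi 0 ∧
              M ≤ |‖FracDiffusionWave.fourierT (fun t => ((f t + φ t : ℝ) : ℂ)) ω‖
                    - ‖FracDiffusionWave.fourierT (fun t => (f t : ℂ)) ω‖| ∧
              |FracDiffusionWave.cVariance P
                    (FracDiffusionWave.boundaryValue P H B α (fun t => f t + φ t) ω)
                  - FracDiffusionWave.cVariance P
                    (FracDiffusionWave.boundaryValue P H B α f ω)| ≤ δ) := by
  -- The maximum with 1 gives positivity at once; the constant is fixed before the probability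
  -- space.
  refine ⟨max 1 (FracDiffusionWave.decayConst H α), by positivity, ?_⟩
  intro Ω _ P _ B hB
  refine ⟨fun ω => ?_, fun hH ω hω => ?_, fun _ hlast => ?_, fun h f hf _ M hM δ hδ => ?_⟩
  · obtain ⟨I, hI⟩ := FracDiffusionWave.exists_isWienerIntegral_green hH0 hH1 hB α ω
    exact ⟨I, hI, fun J hJ => hI.ae_eq hH0 hH1 hB hJ⟩
  · refine (FracDiffusionWave.R_le_decayConst_mul hpos hle hfirst hH hH1 hB hω).trans ?_
    gcongr
    exact le_max_right _ _
  · exact FracDiffusionWave.tendsto_R_of_last_lt_two hH0 hH1 hB hmono hpos hlast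
  · refine FracDiffusionWave.exists_perturbation_of_tendsto_R hH0 hH1 hB ?_ hf hM hδ
    rcases h with h | h
    · exact FracDiffusionWave.tendsto_R_of_half_le hpos hle hfirst h hH1 hB
    · exact FracDiffusionWave.tendsto_R_of_last_lt_two hH0 hH1 hB hmono hpos h
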